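/- For an $M\times N$ integer matrix $A$ ($M,N\ge 1$) let $\Sigma_{22}(A)$ be the $(M-1)\times(N-1)$ matrix of the sums of $A$ over all $2\times 2$ windows, $\Sigma_{22}(A)_{ij}=A_{i,j}+A_{i,j+1}+A_{i+1,j}+A_{i+1,j+1}$. The binary reconstruction problem is: given $M$, $N$ and an $(M-1)\times(N-1)$ integer matrix $S$, find a matrix $A\in\{0,1\}^{M\times N}$ with $\Sigma_{22}(A)=S$, or report that there is none. Theorem. The binary reconstruction problem is solvable in polynomial time; moreover, on a random access machine (RAM) it is solvable in $O(MN)$ time. Precisely, consider a RAM with integer registers and an integer memory, whose instructions are: load a constant, copy, add, subtract, multiply, indirect load and store, jump, jump if zero, jump if negative, and halt. There are one program for this machine, a constant $c$ and a polynomial $p$ such that for all $M,N\ge1$ and every $(M-1)\times(N-1)$ integer matrix $S$, the program, started with $M$, $N$ in two registers and the entries of $S$ in memory in row-major order (all else being zero), halts with a correct answer to the reconstruction problem (any one preimage $A$, or the report that none exists), and 1. it makes at most $c\,MN$ steps; 2. throughout the computation all registers and memory cells hold integers of absolute value at most $c\,(MN+\max_{i,j}|S_{ij}|)$ (the maximum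 being $0$ if $S$ has no entries), i.e. it uses words of $O(\log(MN+\max|S_{ij}|))$ bits; 3. its total logarithmic cost (each executed instruction is charged the binary length of its operands and of the memory address it uses) is at most $p(L)$, where $L$ is the length of the input, with the entries of $S$ written in binary and the dimensions in unary. -/

import Mathlib

/-! ### Random access machine with unit and logarithmic cost -/

namespace RAM

/-- Instructions of a random access machine. Registers are named by natural numbers (a program
mentions only finitely many of them) and hold integers, as do the cells of the memory. Jump targets
are positions in the program. -/
inductive Instr where
  /-- `reg d := z` -/
  | const (d : ℕ) (z : ℤ)
  /-- `reg d := reg a` -/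
  | copy (d a : ℕ)
  /-- `reg d := reg a + reg b` -/
  | add (d a b : ℕ)
  /-- `reg d := reg a - reg b` -/
  | sub (d a b : ℕ)
  /-- `reg d := reg a * reg b` -/
  | mul (d a b : ℕ)
  /-- `reg d := mem (reg a)` -/
  | load (d a : ℕ)
  /-- `mem (reg a) := reg b` -/
  | store (a b : ℕ)
  /-- go to position `l` -/
  | jump (l : ℕ)
  /-- go to position `l` if `reg a = 0` -/
  | jumpZero (a l : ℕ)
  /-- go to position `l` if `reg a < 0` -/
  | jumpNeg (a l : ℕ)
  | halt

/-- A program is a finite list of instructions; it does not depend on the input. -/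
abbrev Program := List Instr

/-- A configuration: program counter, registers, memory. -/
structure Config where
  pc : ℕ
  reg : ℕ → ℤ
  mem : ℕ → ℤ

/-- Write `z` into register `d` and move on to the next instruction. -/
def Config.setReg (s : Config) (d : ℕ) (z : ℤ) : Config :=
  { s with pc := s.pc + 1, reg := Function.update s.reg d z }

/-- Execution of one instruction. There is no next configuration after `halt`, nor after an access
to a negative address (a fault). -/
def exec (s : Config) : Instr → Option Config
  | .const d z => some (s.setReg d z)
  | .copy d a => some (s.setReg d (s.reg a))
  | .add d a b => some (s.setReg d (s.reg a + s.reg b))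
  | .sub d a b => some (s.setReg d (s.reg a - s.reg b))
  | .mul d a b => some (s.setReg d (s.reg a * s.reg b))
  | .load d a => if 0 ≤ s.reg a then some (s.setReg d (s.mem (s.reg a).toNat)) else none
  | .store a b =>
      if 0 ≤ s.reg a then
        some { s with pc := s.pc + 1, mem := Function.update s.mem (s.reg a).toNat (s.reg b) }
      else none
  | .jump l => some { s with pc := l }
  | .jumpZero a l => some { s with pc := if s.reg a = 0 then l else s.pc + 1 }
  | .jumpNeg a l => some { s with pc := if s.reg a < 0 then l else s.pc + 1 }
  | .halt => none

/-- Length of the binary notation of an integer, including a sign. -/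
def len (z : ℤ) : ℕ := Nat.size z.natAbs + 1

/-- Logarithmic cost of one instruction: the total length of its operands and of the memory
address it uses. -/
def logCost (s : Config) : Instr → ℕ
  | .const _ z => len z
  | .copy _ a => len (s.reg a)
  | .add _ a b => len (s.reg a) + len (s.reg b)
  | .sub _ a b => len (s.reg a) + len (s.reg b)
  | .mul _ a b => len (s.reg a) + len (s.reg b)
  | .load _ a => len (s.reg a) + len (s.mem (s.reg a).toNat)
  | .store a b => len (s.reg a) + len (s.reg b)
  | .jump _ => 1
  | .jumpZero a _ => len (s.reg a)
  | .jumpNeg a _ => len (s.reg a)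
  | .halt => 1

/-- `Run P s t w s'`: the program `P` leads from `s` to `s'` in `t` steps, whose total logarithmic
cost is `w`. -/
inductive Run (P : Program) : Config → ℕ → ℕ → Config → Prop
  | refl (s : Config) : Run P s 0 0 s
  | step {s s₁ s₂ : Config} {I : Instr} {t w : ℕ} (fetch : P[s.pc]? = some I)
      (next : exec s I = some s₁) (rest : Run P s₁ t w s₂) :
      Run P s (t + 1) (logCost s I + w) s₂

/-- The program has reached a `halt` instruction. -/
def Halted (P : Program) (s : Config) : Prop := P[s.pc]? = some .halt

/-- Every register and every memory cell holds a number of absolute value at most `B`. -/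
def Config.BoundedBy (s : Config) (B : ℕ) : Prop :=
  (∀ r, (s.reg r).natAbs ≤ B) ∧ ∀ a, (s.mem a).natAbs ≤ B

end RAM

/-! ### The binary reconstruction problem for `2 × 2` windows

The unknown matrix has `m + 1` rows and `n + 1` columns, so that the matrix of its window sums has
`m` rows and `n` columns. -/

namespace WindowSum

/-- The matrix of the sums of `A` over all `2 × 2` windows. -/
def windowSum {m n : ℕ} (A : Matrix (Fin (m + 1)) (Fin (n + 1)) ℤ) : Matrix (Fin m) (Fin n) ℤ :=
  fun i j => A i.castSucc j.castSucc + A i.castSucc j.succ + A i.succ j.castSucc + A i.succ j.succ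

/-- `A` is a 0-1 matrix whose matrix of window sums is `S`. -/
def IsPreimage {m n : ℕ} (S : Matrix (Fin m) (Fin n) ℤ)
    (A : Matrix (Fin (m + 1)) (Fin (n + 1)) ℤ) : Prop :=
  (∀ i j, A i j = 0 ∨ A i j = 1) ∧ windowSum A = S

/-- The initial configuration on input `S`: the dimensions of the unknown matrix are in registers
0 and 1, the entries of `S` are in row-major order in the memory cells `0, …, m * n - 1`, and
everything else is zero. -/
def input {m n : ℕ} (S : Matrix (Fin m) (Fin n) ℤ) : RAM.Config where
  pc := 0
  reg r := if r = 0 then (m : ℤ) + 1 else if r = 1 then (n : ℤ) + 1 else 0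
  mem a := if h : a < m * n then S (Fin.divNat ⟨a, h⟩) (Fin.modNat ⟨a, h⟩) else 0

/-- The `m × n` matrix that is stored in row-major order from cell `0` on. -/
def output (m n : ℕ) (s : RAM.Config) : Matrix (Fin m) (Fin n) ℤ :=
  fun i j => s.mem (i * n + j)

/-- The final configuration answers the reconstruction problem for `S`: either register 0 contains
`1` and the memory contains a preimage of `S`, or register 0 contains `0` and `S` has no
preimage. -/
def Answers {m n : ℕ} (S : Matrix (Fin m) (Fin n) ℤ) (s : RAM.Config) : Prop :=
  (s.reg 0 = 1 ∧ IsPreimage S (output (m + 1) (n + 1) s)) ∨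
    (s.reg 0 = 0 ∧ ¬ ∃ A, IsPreimage S A)

/-- The length of the input: the dimensions in unary notation and the entries of `S` in binary.
(The dimensions are in unary only for the sake of an `S` without entries, whose preimages are
matrices with a single row or column; otherwise the entries of `S` outweigh them.) -/
def inputLength {m n : ℕ} (S : Matrix (Fin m) (Fin n) ℤ) : ℕ :=
  (m + 1) + (n + 1) + ∑ i, ∑ j, RAM.len (S i j)

/-- The largest absolute value of an entry of `S` (zero if there are no entries). -/
def maxAbs {m n : ℕ} (S : Matrix (Fin m) (Fin n) ℤ) : ℕ :=
  Finset.univ.sup fun i => Finset.univ.sup fun j => (S i j).natAbs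

end WindowSum

/-
Replace the entries `A i j` of the `M × N` matrix by `1 - A i j` wherever `i + j` is odd. The window
sums turn into mixed differences, so the 0-1 matrices with window sums `S` become the 0-1 matrices
of the form `D i j + f i + g j`, where `D` is the double sum of the `(-1) ^ (i + j) * (S i j - 2)`.
As the first row of `D` vanishes, `g` may be assumed to have its values in `{0, 1}`, and such a `g`
extends to a solution if and only if the entries of each row of `D i j + g j` differ by at most 1.

Subtract from each row of `D` its minimum. If a row has an entry greater than 1, or a positive entry
in a column where `g` is 1, then `g` must be 1 at all the zeros of that row. In the second case `g`
must even be 1 at the zeros of all rows with at most as many zeros. Hence the forced columns are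
governed by a single number, which is found in at most `N` rounds of `O(M)` steps, and setting `g`
to 1 only in the forced columns works if anything does.

The algorithm is written in a small structured language. A weakest precondition that includes bounds
for all numbers gives its correctness and the size of its words, and its running time is read off
the program text. Bounded words also make every step cheap in the logarithmic cost.
-/

namespace RAM

/-- `Reach P B s t s'`: the program `P` leads from `s` to `s'` in `t` steps, and all configurations
on the way, including both ends, are bounded by `B`. -/
inductive Reach (P : Program) (B : ℕ) : Config → ℕ → Config → Prop
  | refl {s : Config} (bdd : s.BoundedBy B) : Reach P B s 0 s
  | step {s s₁ s₂ : Config} {I : Instr} {t : ℕ} (bdd : s.BoundedBy B) (fetch : P[s.pc]? = some I)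
      (next : exec s I = some s₁) (rest : Reach P B s₁ t s₂) : Reach P B s (t + 1) s₂

/-- The instructions of the list stand in the program from position `k` on. -/
def CodeAt (P : Program) : ℕ → List Instr → Prop
  | _, [] => True
  | k, I :: l => P[k]? = some I ∧ CodeAt P (k + 1) l

variable {P : Program} {B : ℕ} {s s₁ s₂ : Config} {t t' : ℕ}

theorem Reach.trans (h : Reach P B s t s₁) (h' : Reach P B s₁ t' s₂) : Reach P B s (t + t') s₂ := by
  induction h with
  | refl _ => rwa [zero_add]
  | step bdd fetch next _ ih =>
    rw [Nat.add_right_comm]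
    exact .step bdd fetch next (ih h')

theorem Reach.left (h : Reach P B s t s₁) : s.BoundedBy B := by
  cases h <;> assumption

theorem Reach.right (h : Reach P B s t s₁) : s₁.BoundedBy B := by
  induction h <;> assumption

theorem Reach.single {I : Instr} (bdd : s.BoundedBy B) (fetch : P[s.pc]? = some I)
    (next : exec s I = some s₁) (bdd₁ : s₁.BoundedBy B) : Reach P B s 1 s₁ :=
  .step bdd fetch next (.refl bdd₁)

theorem len_le {z : ℤ} (h : z.natAbs ≤ B) : len z ≤ B.size + 1 :=
  Nat.add_le_add_right (Nat.size_le_size h) 1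

theorem logCost_le {I : Instr} (h : s.BoundedBy B) (hI : exec s I = some s₁)
    (h₁ : s₁.BoundedBy B) : logCost s I ≤ 2 * (B.size + 1) := by
  have hreg : ∀ r, len (s.reg r) ≤ B.size + 1 := fun r => len_le (h.1 r)
  cases I with
  | const d z =>
    obtain rfl : s.setReg d z = s₁ := by simpa only [exec, Option.some.injEq] using hI
    have hz : len z ≤ B.size + 1 := by simpa [Config.setReg] using len_le (h₁.1 d)
    simp only [logCost]
    omega
  | load d a =>
    have := hreg a
    have : len (s.mem (s.reg a).toNat) ≤ B.size + 1 := len_le (h.2 _)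
    simp only [logCost]
    omega
  | copy _ a | jumpZero a _ | jumpNeg a _ =>
    have := hreg a
    simp only [logCost]
    omega
  | add _ a b | sub _ a b | mul _ a b | store a b =>
    have := hreg a
    have := hreg b
    simp only [logCost]
    omega
  | jump | halt =>
    simp only [logCost]
    omega

theorem Reach.run (h : Reach P B s t s₁) :
    ∃ w, w ≤ t * (2 * (B.size + 1)) ∧ Run P s t w s₁ := by
  induction h with
  | refl _ => exact ⟨0, Nat.zero_le _, .refl _⟩
  | step bdd fetch next rest ih =>
    obtain ⟨w, hw, hrun⟩ := ih
    refine ⟨_, ?_, .step fetch next hrun⟩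
    have := logCost_le bdd next rest.left
    rw [add_mul, one_mul]
    omega

theorem Reach.boundedBy_of_run (h : Reach P B s t s₁) (halted : Halted P s₁) {w : ℕ}
    (hr : Run P s t' w s₂) : s₂.BoundedBy B := by
  induction h generalizing t' w with
  | refl bdd =>
    cases hr with
    | refl => exact bdd
    | step fetch next _ =>
      obtain rfl : Instr.halt = _ := Option.some.inj (Eq.trans (Eq.symm halted) fetch)
      cases next
  | step bdd fetch next _ ih =>
    cases hr with
    | refl => exact bdd
    | step fetch' next' tail =>
      obtain rfl := Option.some.inj (fetch.symm.trans fetch')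
      obtain rfl := Option.some.inj (next.symm.trans next')
      exact ih halted tail

theorem codeAt_append {k : ℕ} {l l' : List Instr} :
    CodeAt P k (l ++ l') ↔ CodeAt P k l ∧ CodeAt P (k + l.length) l' := by
  induction l generalizing k with
  | nil => simp [CodeAt]
  | cons I l ih =>
    simp only [List.cons_append, CodeAt, ih, and_assoc, List.length_cons, add_assoc, add_comm 1]

theorem codeAt_suffix (l l' : List Instr) : CodeAt (l ++ l') l.length l' := by
  induction l' generalizing l with
  | nil => trivial
  | cons I l' ih => exact ⟨by simp, by simpa using ih (l ++ [I])⟩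

theorem Config.BoundedBy.setReg (h : s.BoundedBy B) {z : ℤ} (hz : z.natAbs ≤ B) (d : ℕ) :
    (s.setReg d z).BoundedBy B := by
  refine ⟨fun r => ?_, h.2⟩
  rcases eq_or_ne r d with rfl | hr
  · simpa [Config.setReg] using hz
  · simpa [Config.setReg, hr] using h.1 r

theorem Config.BoundedBy.setMem (h : s.BoundedBy B) {z : ℤ} (hz : z.natAbs ≤ B) (l a : ℕ) :
    { s with pc := l, mem := Function.update s.mem a z }.BoundedBy B := by
  refine ⟨h.1, fun b => ?_⟩
  rcases eq_or_ne b a with rfl | hb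
  · simpa using hz
  · simpa [hb] using h.2 b

end RAM

/-! ### Balancing the columns of a matrix -/

namespace WindowSum

/-- The minimum of the number `b` and of the numbers `f k` for those `k < n` that satisfy `p`. -/
noncomputable def minWhere (n : ℕ) (p : ℕ → Prop) (b : ℤ) (f : ℕ → ℤ) : ℤ :=
  open Classical in {k ∈ Finset.range n | p k}.fold min b f

theorem le_minWhere {n : ℕ} {p : ℕ → Prop} {b z : ℤ} {f : ℕ → ℤ} :
    z ≤ minWhere n p b f ↔ z ≤ b ∧ ∀ k < n, p k → z ≤ f k := by
  simp only [minWhere, Finset.le_fold_min, Finset.mem_filter, Finset.mem_range, and_imp]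

theorem minWhere_le {n : ℕ} {p : ℕ → Prop} {b z : ℤ} {f : ℕ → ℤ} :
    minWhere n p b f ≤ z ↔ b ≤ z ∨ ∃ k < n, p k ∧ f k ≤ z := by
  simp only [minWhere, Finset.fold_min_le, Finset.mem_filter, Finset.mem_range, and_assoc]

theorem minWhere_succ (n : ℕ) (p : ℕ → Prop) [Decidable (p n)] (b : ℤ) (f : ℕ → ℤ) :
    minWhere (n + 1) p b f = if p n then min (f n) (minWhere n p b f) else minWhere n p b f := by
  classical
  rw [minWhere, Finset.range_add_one, Finset.filter_insert]
  split_ifs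
  · rw [Finset.fold_insert (by simp), minWhere]
  · rw [minWhere]

theorem natAbs_minWhere_le {n L : ℕ} {p : ℕ → Prop} {b : ℤ} {f : ℕ → ℤ} (hb : b.natAbs ≤ L)
    (hf : ∀ k < n, (f k).natAbs ≤ L) : (minWhere n p b f).natAbs ≤ L := by
  have hlower : -(L : ℤ) ≤ minWhere n p b f :=
    le_minWhere.2 ⟨by omega, fun k hk _ => by have := hf k hk; omega⟩
  have hupper : minWhere n p b f ≤ L := minWhere_le.2 (.inl (by omega))
  omega

section Balanced

variable {M N : ℕ} {W V : ℕ → ℕ → ℤ} {v w y : ℕ → ℤ} {q : ℤ} {i j : ℕ}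

/-- The least entry of row `i`. -/
noncomputable def rowMin (N : ℕ) (W : ℕ → ℕ → ℤ) (i : ℕ) : ℤ :=
  minWhere N (fun _ => True) (W i 0) (W i)

/-- The matrix with each row shifted so that its least entry is zero. -/
noncomputable def normalized (N : ℕ) (W : ℕ → ℕ → ℤ) (i j : ℕ) : ℤ := W i j - rowMin N W i

theorem normalized_nonneg (hj : j < N) : 0 ≤ normalized N W i j :=
  sub_nonneg.2 (minWhere_le.2 (.inr ⟨j, hj, trivial, le_rfl⟩))

theorem exists_normalized_eq_zero (hN : 0 < N) (W : ℕ → ℕ → ℤ) (i : ℕ) :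
    ∃ j < N, normalized N W i j = 0 := by
  obtain h | ⟨j, hj, -, h⟩ := minWhere_le.1 (le_refl (rowMin N W i))
  · exact ⟨0, hN, le_antisymm (sub_nonpos.2 h) (normalized_nonneg hN)⟩
  · exact ⟨j, hj, le_antisymm (sub_nonpos.2 h) (normalized_nonneg hj)⟩

theorem natAbs_rowMin_le {L : ℕ} (hN : 0 < N) (hW : ∀ j < N, (W i j).natAbs ≤ L) :
    (rowMin N W i).natAbs ≤ L :=
  natAbs_minWhere_le (hW 0 hN) hW

theorem natAbs_normalized_le {L : ℕ} (hW : ∀ j < N, (W i j).natAbs ≤ L) (hj : j < N) :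
    (normalized N W i j).natAbs ≤ 2 * L := by
  have h₁ := natAbs_rowMin_le (by omega) hW
  have h₂ := hW j hj
  rw [normalized]
  omega

/-- Column offsets `y` with values in `{0, 1}` for which the entries of each row of `V i j + y j`
differ by at most 1. -/
def Balanced (M N : ℕ) (V : ℕ → ℕ → ℤ) (y : ℕ → ℤ) : Prop :=
  (∀ j < N, y j = 0 ∨ y j = 1) ∧
    ∀ i < M, ∀ a < N, ∀ b < N, V i a + y a ≤ V i b + y b + 1

theorem balanced_iff_normalized_le_one (hy : ∀ j < N, y j = 0 ∨ y j = 1) :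
    Balanced M N V y ↔ ∀ i < M, ∀ j < N, normalized N (fun i j => V i j + y j) i j ≤ 1 := by
  refine ⟨fun h i hi j hj => ?_, fun h => ⟨hy, fun i hi a ha b hb => ?_⟩⟩
  · obtain ⟨b, hb, hb₀⟩ :=
      exists_normalized_eq_zero (j.zero_le.trans_lt hj) (fun i j => V i j + y j) i
    have := h.2 i hi j hj b hb
    simp only [normalized] at hb₀ ⊢
    omega
  · have h₁ := h i hi a ha
    have h₂ := normalized_nonneg (W := fun i j => V i j + y j) (i := i) hb
    simp only [normalized] at h₁ h₂
    omega

/-- The number of zeros among the first `N` terms. -/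
def zeros (N : ℕ) (v : ℕ → ℤ) : ℕ := {j ∈ Finset.range N | v j = 0}.card

theorem zeros_succ (N : ℕ) (v : ℕ → ℤ) :
    zeros (N + 1) v = if v N = 0 then zeros N v + 1 else zeros N v := by
  rw [zeros, Finset.range_add_one, Finset.filter_insert]
  split_ifs
  · rw [Finset.card_insert_of_notMem (by simp), zeros]
  · rw [zeros]

theorem zeros_pos (hj : j < N) (hv : v j = 0) : 0 < zeros N v :=
  Finset.card_pos.2 ⟨j, by simp [hj, hv]⟩

theorem zeros_lt_zeros (hj : j < N) (hv : v j ≠ 0) (hw : w j = 0)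
    (h : ∀ b < N, v b = 0 → w b = 0) : zeros N v < zeros N w :=
  Finset.card_lt_card ⟨fun b hb => by
    simp only [Finset.mem_filter, Finset.mem_range] at hb ⊢
    exact ⟨hb.1, h b hb.1 hb.2⟩, fun hsub => by
    simpa [hj, hv, hw] using @hsub j⟩

/-- The number of zeros of row `i`, but 0 if some entry exceeds 1: in that case all the zeros must
get the offset 1. -/
noncomputable def cost (N : ℕ) (V : ℕ → ℕ → ℤ) (i : ℕ) : ℤ :=
  minWhere N (fun j => 2 ≤ V i j) (zeros N (V i)) 0

/-- The least cost of a row that has a zero in column `j`, or `N + 1`. -/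
noncomputable def level (M N : ℕ) (V : ℕ → ℕ → ℤ) (j : ℕ) : ℤ :=
  minWhere M (fun i => V i j = 0) (N + 1) (cost N V)

/-- The least level of a column in which row `i` has a positive entry, or `N + 1`. -/
noncomputable def reach (M N : ℕ) (V : ℕ → ℕ → ℤ) (i : ℕ) : ℤ :=
  minWhere N (fun j => 0 < V i j) (N + 1) (level M N V)

/-- The offsets of the columns up to level `q`. -/
noncomputable def offset (M N : ℕ) (V : ℕ → ℕ → ℤ) (q : ℤ) (j : ℕ) : ℤ :=
  if level M N V j ≤ q then 1 else 0

/-- All balanced offsets are 1 in the columns up to level `q`. -/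
def Forced (M N : ℕ) (V : ℕ → ℕ → ℤ) (q : ℤ) : Prop :=
  ∀ y, Balanced M N V y → ∀ j < N, level M N V j ≤ q → y j = 1

/-- The rows with a positive entry in a column up to level `q` cost at most `q`. -/
def Closed (M N : ℕ) (V : ℕ → ℕ → ℤ) (q : ℤ) : Prop :=
  ∀ i < M, reach M N V i ≤ q → cost N V i ≤ q

theorem zeros_le (N : ℕ) (v : ℕ → ℤ) : zeros N v ≤ N :=
  (Finset.card_filter_le _ _).trans_eq (Finset.card_range N)

theorem cost_le_zeros (N : ℕ) (V : ℕ → ℕ → ℤ) (i : ℕ) : cost N V i ≤ zeros N (V i) :=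
  minWhere_le.2 (.inl le_rfl)

theorem cost_le (N : ℕ) (V : ℕ → ℕ → ℤ) (i : ℕ) : cost N V i ≤ N :=
  (cost_le_zeros N V i).trans (by exact_mod_cast zeros_le N (V i))

theorem natAbs_cost_le (N : ℕ) (V : ℕ → ℕ → ℤ) (i : ℕ) : (cost N V i).natAbs ≤ N :=
  natAbs_minWhere_le (by simpa using zeros_le N (V i)) (by simp)

theorem natAbs_level_le (M N : ℕ) (V : ℕ → ℕ → ℤ) (j : ℕ) : (level M N V j).natAbs ≤ N + 1 :=
  natAbs_minWhere_le (by omega) fun i _ => (natAbs_cost_le N V i).trans N.le_succ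

theorem natAbs_reach_le (M N : ℕ) (V : ℕ → ℕ → ℤ) (i : ℕ) : (reach M N V i).natAbs ≤ N + 1 :=
  natAbs_minWhere_le (by omega) fun j _ => natAbs_level_le M N V j

theorem exists_row_of_level_le (h : level M N V j ≤ q) (hq : q ≤ N) :
    ∃ i < M, V i j = 0 ∧ cost N V i ≤ q :=
  (minWhere_le.1 h).resolve_left (by omega)

theorem exists_column_of_reach_le (h : reach M N V i ≤ q) (hq : q ≤ N) :
    ∃ j < N, 0 < V i j ∧ level M N V j ≤ q :=
  (minWhere_le.1 h).resolve_left (by omega)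

theorem Balanced.eq_one (hy : Balanced M N V y) {a b : ℕ} (hi : i < M) (ha : a < N) (hb : b < N)
    (hva : 0 < V i a) (hya : y a = 1) (hvb : V i b = 0) : y b = 1 := by
  have := hy.2 i hi a ha b hb
  have := hy.1 b hb
  omega

theorem Balanced.zeros_le_cost (hy : Balanced M N V y) (hi : i < M) (hj : j < N)
    (hv : V i j = 0) (hyj : y j ≠ 1) : zeros N (V i) ≤ cost N V i := by
  refine le_minWhere.2 ⟨le_rfl, fun a ha hva => ?_⟩
  have := hy.2 i hi a ha j hj
  have := hy.1 j hj
  have := hy.1 a ha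
  omega

theorem forced_zero : Forced M N V 0 := by
  intro y hy j hj hlevel
  by_contra hyj
  obtain ⟨i, hi, hv, hcost⟩ := exists_row_of_level_le hlevel N.cast_nonneg
  have h₁ := zeros_pos hj hv
  have h₂ := hy.zeros_le_cost hi hj hv hyj
  omega

/- If the zero of row `k` in column `j` kept the offset 0, all columns with offset 1 would be zeros
of row `k`: those are the zeros of row `i`, which are forced, and the column that forces them. -/
theorem Forced.cost_of_reach_le (hV : ∀ i < M, ∀ j < N, 0 ≤ V i j) (hq : q ≤ N)
    (h : Forced M N V q) (hi : i < M) (hreach : reach M N V i ≤ q) : Forced M N V (cost N V i) := by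
  intro y hy j hj hlevel
  obtain ⟨a, ha, hva, hlevel_a⟩ := exists_column_of_reach_le hreach hq
  have hya : y a = 1 := h y hy a ha hlevel_a
  obtain ⟨k, hk, hvk, hcost⟩ := exists_row_of_level_le hlevel (cost_le N V i)
  by_contra hyj
  have hzero : ∀ b < N, y b = 1 → V k b = 0 := fun b hb hyb => by
    by_contra hvb
    exact hyj (hy.eq_one hk hb hj ((hV k hk b hb).lt_of_ne' hvb) hyb hvk)
  have hlt : zeros N (V i) < zeros N (V k) :=
    zeros_lt_zeros ha hva.ne' (hzero a ha hya) fun b hb hvb =>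
      hzero b hb (hy.eq_one hi ha hb hva hya hvb)
  have h₁ := cost_le_zeros N V i
  have h₂ := hy.zeros_le_cost hk hj hvk hyj
  omega

theorem closed_of_le (h : N ≤ q) : Closed M N V q := fun i _ _ => (cost_le N V i).trans h

/-- The threshold `q`, raised to the cost of row `i` if that row is reached. -/
noncomputable def raised (M N : ℕ) (V : ℕ → ℕ → ℤ) (q : ℤ) (i : ℕ) : ℤ :=
  if reach M N V i ≤ q then max q (cost N V i) else q

theorem raised_le (hq : q ≤ N) : raised M N V q i ≤ N := by
  rw [raised]
  split_ifs
  · exact max_le hq (cost_le N V i)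
  · exact hq

theorem le_raised : q ≤ raised M N V q i := by
  rw [raised]
  split_ifs
  · exact le_max_left _ _
  · exact le_rfl

theorem raised_eq_self : raised M N V q i = q ↔ (reach M N V i ≤ q → cost N V i ≤ q) := by
  rw [raised]
  split_ifs with h <;> simp [h]

theorem Forced.raised (hV : ∀ i < M, ∀ j < N, 0 ≤ V i j) (hq : q ≤ N) (h : Forced M N V q)
    (hi : i < M) : Forced M N V (raised M N V q i) := by
  rw [WindowSum.raised]
  split_ifs with hreach
  · rcases max_choice q (cost N V i) with hmax | hmax <;> rw [hmax]
    exacts [h, h.cost_of_reach_le hV hq hi hreach]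
  · exact h

theorem offset_eq_zero_or_one (M N : ℕ) (V : ℕ → ℕ → ℤ) (q : ℤ) (j : ℕ) :
    offset M N V q j = 0 ∨ offset M N V q j = 1 := by
  unfold offset
  split_ifs <;> simp

theorem offset_eq_one_of_closed (h : Closed M N V q) {a b : ℕ} (hi : i < M) (ha : a < N)
    (hva : 0 < V i a) (hvb : V i b = 0) (hone : offset M N V q a = 1 ∨ 2 ≤ V i a)
    (hq : 0 ≤ q) : offset M N V q b = 1 := by
  have hcost : cost N V i ≤ q := by
    rcases hone with hone | hva₂
    · have hlevel : level M N V a ≤ q := by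
        by_contra hlt
        simp [offset, hlt] at hone
      exact h i hi (minWhere_le.2 (.inr ⟨a, ha, hva, hlevel⟩))
    · exact minWhere_le.2 (.inr ⟨a, ha, hva₂, hq⟩)
  exact if_pos (minWhere_le.2 (.inr ⟨i, hi, hvb, hcost⟩))

theorem Balanced.offset_le (hy : Balanced M N V y) (h : Forced M N V q) (hj : j < N) :
    offset M N V q j ≤ y j := by
  rw [offset]
  split_ifs with hlevel
  · exact (h y hy j hj hlevel).ge
  · have := hy.1 j hj
    omega

theorem Balanced.offset (hy : Balanced M N V y) (hV : ∀ i < M, ∀ j < N, 0 ≤ V i j)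
    (hV₀ : ∀ i < M, ∃ j < N, V i j = 0) (hq : 0 ≤ q) (hforced : Forced M N V q)
    (hclosed : Closed M N V q) : Balanced M N V (offset M N V q) := by
  refine ⟨fun j _ => offset_eq_zero_or_one M N V q j, fun i hi a ha b hb => ?_⟩
  obtain ⟨l, hl, hvl⟩ := hV₀ i hi
  have hal := hy.2 i hi a ha l hl
  have hyl := hy.1 l hl
  have hle := hy.offset_le hforced ha
  have hvb := hV i hi b hb
  have h₀ := offset_eq_zero_or_one M N V q b
  have h₁ := offset_eq_zero_or_one M N V q a
  have hya := hy.1 a ha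
  by_contra! hlt
  refine absurd (offset_eq_one_of_closed hclosed hi ha (a := a) (b := b) ?_ ?_ ?_ hq) ?_ <;> omega

end Balanced

/-! ### Window sums and double sums -/

section Reflect

variable {m n : ℕ} {S A Z : ℕ → ℕ → ℤ} {q : ℤ}

/-- A window sum of a 0-1 matrix is at least 0 and at most 4. -/
def InRange (z : ℤ) : Prop := 0 ≤ z ∧ z ≤ 4

open Classical in
/-- The signed window sums of the matrix with every other entry `z` replaced by `1 - z`; entries of
`S` out of range are treated as 2. -/
noncomputable def mixedDiff (S : ℕ → ℕ → ℤ) (i j : ℕ) : ℤ :=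
  ((if InRange (S i j) then S i j else 2) - 2) * (-1) ^ (i + j)

/-- Double sums of the mixed differences. -/
noncomputable def doubleSum (S : ℕ → ℕ → ℤ) (i j : ℕ) : ℤ :=
  ∑ a ∈ Finset.range i, ∑ b ∈ Finset.range j, mixedDiff S a b

theorem doubleSum_succ (S : ℕ → ℕ → ℤ) (i j : ℕ) : doubleSum S (i + 1) (j + 1) =
    mixedDiff S i j + doubleSum S i (j + 1) + doubleSum S (i + 1) j - doubleSum S i j := by
  simp only [doubleSum, Finset.sum_range_succ, Finset.sum_add_distrib]
  ring

theorem abs_mixedDiff_le (S : ℕ → ℕ → ℤ) (i j : ℕ) : |mixedDiff S i j| ≤ 2 := by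
  rw [mixedDiff, abs_mul, abs_neg_one_pow, mul_one, abs_le]
  split_ifs with h
  · exact ⟨by linarith [h.1], by linarith [h.2]⟩
  · norm_num

theorem natAbs_doubleSum_le (S : ℕ → ℕ → ℤ) (i j : ℕ) :
    (doubleSum S i j).natAbs ≤ 2 * (i * j) := by
  have h : |doubleSum S i j| ≤ ∑ a ∈ Finset.range i, ∑ b ∈ Finset.range j, 2 :=
    (Finset.abs_sum_le_sum_abs _ _).trans <| Finset.sum_le_sum fun a _ =>
      (Finset.abs_sum_le_sum_abs _ _).trans <| Finset.sum_le_sum fun b _ => abs_mixedDiff_le S a b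
  simp only [Finset.sum_const, Finset.card_range, nsmul_eq_mul] at h
  zify
  linarith

theorem eq_doubleSum_add (h : ∀ i < m, ∀ j < n,
    Z i j - Z i (j + 1) - Z (i + 1) j + Z (i + 1) (j + 1) = mixedDiff S i j) {i j : ℕ}
    (hi : i < m + 1) (hj : j < n + 1) : Z i j = doubleSum S i j + Z i 0 + Z 0 j - Z 0 0 := by
  induction i generalizing j with
  | zero => simp [doubleSum]
  | succ i ih =>
    induction j with
    | zero => simp [doubleSum]
    | succ j ih' =>
      have h₁ := ih (by omega) hj
      have h₂ := ih (j := j) (by omega) (by omega)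
      have h₃ := ih' (by omega)
      have h₄ := h i (by omega) j (by omega)
      rw [doubleSum_succ]
      linarith

/-- The number `z`, reflected in `1 / 2` if `k` is odd. -/
def reflect (k : ℕ) (z : ℤ) : ℤ := if Even k then z else 1 - z

theorem reflect_reflect (k : ℕ) (z : ℤ) : reflect k (reflect k z) = z := by
  unfold reflect
  split_ifs <;> ring

theorem reflect_eq_zero_or_one {k : ℕ} {z : ℤ} (h : z = 0 ∨ z = 1) :
    reflect k z = 0 ∨ reflect k z = 1 := by
  unfold reflect
  split_ifs <;> omega

theorem reflect_window (A : ℕ → ℕ → ℤ) (i j : ℕ) :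
    reflect (i + j) (A i j) - reflect (i + (j + 1)) (A i (j + 1)) -
        reflect (i + 1 + j) (A (i + 1) j) + reflect (i + 1 + (j + 1)) (A (i + 1) (j + 1)) =
      (A i j + A i (j + 1) + A (i + 1) j + A (i + 1) (j + 1) - 2) * (-1) ^ (i + j) := by
  have h₁ : Even (i + (j + 1)) ↔ ¬ Even (i + j) := Nat.even_add_one
  have h₂ : Even (i + 1 + j) ↔ ¬ Even (i + j) := by rw [add_right_comm, Nat.even_add_one]
  have h₃ : Even (i + 1 + (j + 1)) ↔ Even (i + j) := by
    rw [← add_assoc, Nat.even_add_one, h₂, not_not]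
  simp only [reflect, h₁, h₂, h₃]
  rcases Nat.even_or_odd (i + j) with h | h
  · simp only [h, h.neg_one_pow, not_true, if_true, if_false]
    ring
  · simp only [Nat.not_even_iff_odd.2 h, h.neg_one_pow, not_false_iff, if_true, if_false]
    ring

/-- A solution of the reconstruction problem, for matrices indexed by natural numbers. -/
def IsSolution (m n : ℕ) (S A : ℕ → ℕ → ℤ) : Prop :=
  (∀ i < m + 1, ∀ j < n + 1, A i j = 0 ∨ A i j = 1) ∧
    ∀ i < m, ∀ j < n, A i j + A i (j + 1) + A (i + 1) j + A (i + 1) (j + 1) = S i j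

theorem IsSolution.congr (hA : IsSolution m n S A)
    (h : ∀ i < m + 1, ∀ j < n + 1, A i j = Z i j) : IsSolution m n S Z := by
  refine ⟨fun i hi j hj => h i hi j hj ▸ hA.1 i hi j hj, fun i hi j hj => ?_⟩
  rw [← h i (by omega) j (by omega), ← h i (by omega) (j + 1) (by omega),
    ← h (i + 1) (by omega) j (by omega), ← h (i + 1) (by omega) (j + 1) (by omega), hA.2 i hi j hj]

theorem IsSolution.inRange (hA : IsSolution m n S A) : ∀ i < m, ∀ j < n, InRange (S i j) := by
  intro i hi j hj
  rw [← hA.2 i hi j hj]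
  have h₁ := hA.1 i (by omega) j (by omega)
  have h₂ := hA.1 i (by omega) (j + 1) (by omega)
  have h₃ := hA.1 (i + 1) (by omega) j (by omega)
  have h₄ := hA.1 (i + 1) (by omega) (j + 1) (by omega)
  constructor <;> omega

theorem IsSolution.reflect_eq (hA : IsSolution m n S A) {i j : ℕ} (hi : i < m + 1)
    (hj : j < n + 1) :
    reflect (i + j) (A i j) =
      doubleSum S i j + reflect i (A i 0) + reflect j (A 0 j) - reflect 0 (A 0 0) := by
  have h := eq_doubleSum_add (S := S) (Z := fun i j => reflect (i + j) (A i j))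
    (fun i hi j hj => ?_) hi hj
  · simpa only [add_zero, zero_add] using h
  · rw [reflect_window, hA.2 i hi j hj, mixedDiff, if_pos (hA.inRange i hi j hj)]

theorem IsSolution.balanced (hA : IsSolution m n S A) :
    Balanced (m + 1) (n + 1) (normalized (n + 1) (doubleSum S)) fun j => reflect j (A 0 j) := by
  have hbinary : ∀ i < m + 1, ∀ j < n + 1,
      reflect (i + j) (A i j) = 0 ∨ reflect (i + j) (A i j) = 1 :=
    fun i hi j hj => reflect_eq_zero_or_one (hA.1 i hi j hj)
  refine ⟨fun j hj => by simpa using hbinary 0 m.succ_pos j hj, fun i hi a ha b hb => ?_⟩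
  have h₁ := hA.reflect_eq hi ha
  have h₂ := hA.reflect_eq hi hb
  have h₃ := hbinary i hi a ha
  have h₄ := hbinary i hi b hb
  simp only [normalized]
  omega

theorem isSolution_reflect (hS : ∀ i < m, ∀ j < n, InRange (S i j))
    (hZ : ∀ i < m, ∀ j < n,
      Z i j - Z i (j + 1) - Z (i + 1) j + Z (i + 1) (j + 1) = mixedDiff S i j)
    (hbinary : ∀ i < m + 1, ∀ j < n + 1, Z i j = 0 ∨ Z i j = 1) :
    IsSolution m n S fun i j => reflect (i + j) (Z i j) := by
  refine ⟨fun i hi j hj => reflect_eq_zero_or_one (hbinary i hi j hj), fun i hi j hj => ?_⟩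
  have h := reflect_window (fun i j => reflect (i + j) (Z i j)) i j
  simp only [reflect_reflect] at h
  rw [hZ i hi j hj, mixedDiff, if_pos (hS i hi j hj)] at h
  linarith [mul_right_cancel₀ (pow_ne_zero _ (by norm_num)) h]

/-- The column offsets, subject to the threshold `q`, added to the normalized double sums. -/
noncomputable def leveled (m n : ℕ) (S : ℕ → ℕ → ℤ) (q : ℤ) : ℕ → ℕ → ℤ :=
  normalized (n + 1) fun i j => normalized (n + 1) (doubleSum S) i j +
    offset (m + 1) (n + 1) (normalized (n + 1) (doubleSum S)) q j

theorem isSolution_of_leveled_le_one (hS : ∀ i < m, ∀ j < n, InRange (S i j))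
    (h : ∀ i < m + 1, ∀ j < n + 1, leveled m n S q i j ≤ 1) :
    IsSolution m n S fun i j => reflect (i + j) (leveled m n S q i j) := by
  refine isSolution_reflect hS (fun i _ j _ => ?_) fun i hi j hj => ?_
  · simp only [leveled, normalized, doubleSum_succ]
    ring
  · have := h i hi j hj
    have : 0 ≤ leveled m n S q i j := normalized_nonneg hj
    omega

theorem IsSolution.leveled_le_one (hA : IsSolution m n S A) (hq : 0 ≤ q)
    (hforced : Forced (m + 1) (n + 1) (normalized (n + 1) (doubleSum S)) q)
    (hclosed : Closed (m + 1) (n + 1) (normalized (n + 1) (doubleSum S)) q) :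
    ∀ i < m + 1, ∀ j < n + 1, leveled m n S q i j ≤ 1 :=
  (balanced_iff_normalized_le_one fun _ _ => offset_eq_zero_or_one ..).1 <|
    hA.balanced.offset (fun _ _ _ hj => normalized_nonneg hj)
      (fun i _ => exists_normalized_eq_zero n.succ_pos _ i) hq hforced hclosed

end Reflect

end WindowSum

/-! ### A structured language with loops and arrays -/

namespace ArrayProgram

open RAM

/-- The variables of the language. -/
inductive Var where
  | row | col | round | best | sign | rowSign | cutoff | bad
  deriving DecidableEq

/-- The arrays of the language, all of the same format `M × N`. -/
inductive Arr where
  | io | table | cost | level | reach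
  deriving DecidableEq

/-- The two directions of a matrix. -/
inductive Axis where
  | rows | cols

/-- The number of rows or of columns. -/
def extent (M N : ℕ) : Axis → ℕ
  | .rows => M
  | .cols => N

/-- Arithmetical operations. -/
inductive Op where
  | add | sub | mul

/-- The value of an operation. -/
def Op.eval : Op → ℤ → ℤ → ℤ
  | .add => (· + ·)
  | .sub => (· - ·)
  | .mul => (· * ·)

/-- Expressions: `dim a` is the number of rows or of columns, `entry k i j` an array entry, and
`flat p` the entry of the array `io` whose row-major index is `p`. -/
inductive Expr where
  | const (z : ℤ)
  | var (v : Var)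
  | dim (a : Axis)
  | op (o : Op) (e e' : Expr)
  | entry (k : Arr) (i j : Expr)
  | flat (p : Expr)

instance : Coe Var Expr := ⟨.var⟩
instance (n : ℕ) : OfNat Expr n := ⟨.const n⟩
instance : Add Expr := ⟨.op .add⟩
instance : Sub Expr := ⟨.op .sub⟩
instance : Mul Expr := ⟨.op .mul⟩

/-- The conditions that a branch can test: a number is negative, or it is zero. -/
inductive Test where
  | neg | zero

/-- The number `z` passes the test. -/
def Test.Holds : Test → ℤ → Prop
  | .neg, z => z < 0
  | .zero, z => z = 0

/-- Statements. `loop v a c` runs `c` with `v` counting the row or the column indices. -/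
inductive Stmt where
  | skip
  | assign (v : Var) (e : Expr)
  | store (k : Arr) (i j e : Expr)
  | seq (c c' : Stmt)
  | ite (t : Test) (e : Expr) (c c' : Stmt)
  | loop (v : Var) (a : Axis) (c : Stmt)

infix:62 "::=" => Stmt.assign
infixr:60 ";;" => Stmt.seq

/-- A state: the values of the variables and of the array entries. -/
structure State where
  var : Var → ℤ
  arr : Arr → ℕ → ℕ → ℤ

/-- Assignment to a variable. -/
def State.set (s : State) (v : Var) (z : ℤ) : State :=
  { s with var := Function.update s.var v z }

/-- Assignment to an array entry. -/
def State.setArr (s : State) (k : Arr) (i j : ℕ) (z : ℤ) : State :=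
  { s with arr := fun k' i' j' => if k' = k ∧ i' = i ∧ j' = j then z else s.arr k' i' j' }

/-- The value of an expression. It is meaningful only if the indices are in range. -/
def Expr.eval (M N : ℕ) (s : State) : Expr → ℤ
  | .const z => z
  | .var v => s.var v
  | .dim a => extent M N a
  | .op o e e' => o.eval (e.eval M N s) (e'.eval M N s)
  | .entry k i j => s.arr k (i.eval M N s).toNat (j.eval M N s).toNat
  | .flat p => s.arr .io ((p.eval M N s).toNat / N) ((p.eval M N s).toNat % N)

/-- The numbers `i` and `j` are the indices of an entry of an `M × N` matrix. -/
def InBounds (M N : ℕ) (i j : ℤ) : Prop := (0 ≤ i ∧ i < M) ∧ 0 ≤ j ∧ j < N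

/-- The evaluation of the expression meets only indices in range and numbers bounded by `B`. -/
def Expr.Safe (M N B : ℕ) (s : State) : Expr → Prop
  | .const z => z.natAbs ≤ B
  | .var _ | .dim _ => True
  | .op o e e' => e.Safe M N B s ∧ e'.Safe M N B s ∧
      (o.eval (e.eval M N s) (e'.eval M N s)).natAbs ≤ B
  | .entry _ i j => i.Safe M N B s ∧ j.Safe M N B s ∧ InBounds M N (i.eval M N s) (j.eval M N s)
  | .flat p => p.Safe M N B s ∧ 0 ≤ p.eval M N s ∧ p.eval M N s < M * N

/-- Weakest precondition of `n` rounds of a loop whose counter `v` has the value `k`. -/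
def wpIter (body : (State → Prop) → State → Prop) (v : Var) (Q : State → Prop) :
    ℕ → ℕ → State → Prop
  | 0, _, s => Q s
  | n + 1, k, s =>
    body (fun s' => s'.var v = k ∧ wpIter body v Q n (k + 1) (s'.set v ((k : ℤ) + 1))) s

/-- Weakest precondition: all expressions are evaluated safely, and the final state satisfies
`Q`. -/
def wp (M N B : ℕ) : Stmt → (State → Prop) → State → Prop
  | .skip, Q, s => Q s
  | .assign v e, Q, s => e.Safe M N B s ∧ Q (s.set v (e.eval M N s))
  | .store k i j e, Q, s =>
      (i.Safe M N B s ∧ j.Safe M N B s ∧ InBounds M N (i.eval M N s) (j.eval M N s)) ∧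
        e.Safe M N B s ∧
        Q (s.setArr k (i.eval M N s).toNat (j.eval M N s).toNat (e.eval M N s))
  | .seq c c', Q, s => wp M N B c (wp M N B c' Q) s
  | .ite t e c c', Q, s => e.Safe M N B s ∧ (t.Holds (e.eval M N s) → wp M N B c Q s) ∧
      (¬ t.Holds (e.eval M N s) → wp M N B c' Q s)
  | .loop v a c, Q, s => wpIter (wp M N B c) v Q (extent M N a) 0 (s.set v 0)

/-! ### Compilation -/

/-- The position of an array in memory. -/
def Arr.index : Arr → ℕ
  | .io => 0 | .table => 1 | .cost => 2 | .level => 3 | .reach => 4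

/-- The register of a variable. -/
def Var.reg : Var → ℕ
  | .row => 2 | .col => 3 | .round => 4 | .best => 5 | .sign => 6 | .rowSign => 7 | .cutoff => 8
  | .bad => 9

/-- The register that holds the number of rows or of columns. -/
def Axis.reg : Axis → ℕ
  | .rows => 0
  | .cols => 1

/-- The registers for intermediate results. -/
def stack (d : ℕ) : ℕ := d + 10

/-- The instruction for an arithmetical operation. -/
def Op.instr : Op → ℕ → ℕ → ℕ → Instr
  | .add => .add
  | .sub => .sub
  | .mul => .mul

/-- The instruction for a conditional jump. -/
def Test.instr : Test → ℕ → ℕ → Instr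
  | .neg => .jumpNeg
  | .zero => .jumpZero

/-- The memory address of an array entry. -/
def address (M N : ℕ) (k : Arr) (i j : ℕ) : ℕ := k.index * M * N + (i * N + j)

/-- Code for an operation, from codes that leave the operands in `stack d` and `stack (d + 1)`. -/
def opCode (o : Op) (d : ℕ) (l l' : List Instr) : List Instr :=
  l ++ l' ++ [o.instr (stack d) (stack d) (stack (d + 1))]

/-- Code for the address of an array entry, from codes for its indices. -/
def addressCode (k : Arr) (d : ℕ) (l l' : List Instr) : List Instr :=
  opCode .add d
    (opCode .mul d (opCode .mul d [.const (stack d) k.index] [.copy (stack (d + 1)) 0])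
      [.copy (stack (d + 1)) 1])
    (opCode .add (d + 1) (opCode .mul (d + 1) l [.copy (stack (d + 2)) 1]) l')

/-- Code that leaves the value of the expression in `stack d`. -/
def Expr.code : Expr → ℕ → List Instr
  | .const z, d => [.const (stack d) z]
  | .var v, d => [.copy (stack d) v.reg]
  | .dim a, d => [.copy (stack d) a.reg]
  | .op o e e', d => opCode o d (e.code d) (e'.code (d + 1))
  | .entry k i j, d =>
      addressCode k d (i.code (d + 1)) (j.code (d + 2)) ++ [.load (stack d) (stack d)]
  | .flat p, d => p.code d ++ [.load (stack d) (stack d)]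

/-- Length of the code of an expression. -/
def Expr.size : Expr → ℕ
  | .const _ | .var _ | .dim _ => 1
  | .op _ e e' => e.size + e'.size + 1
  | .entry _ i j => i.size + j.size + 10
  | .flat p => p.size + 1

/-- Length of the code of a statement. -/
def Stmt.size : Stmt → ℕ
  | .skip => 0
  | .assign _ e => e.size + 1
  | .store _ i j e => i.size + j.size + e.size + 10
  | .seq c c' => c.size + c'.size
  | .ite _ e c c' => e.size + c.size + c'.size + 2
  | .loop _ _ c => c.size + 12

/-- Bound for the running time. -/
def Stmt.time (M N : ℕ) : Stmt → ℕ
  | .skip => 0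
  | .assign _ e => e.size + 1
  | .store _ i j e => i.size + j.size + e.size + 10
  | .seq c c' => c.time M N + c'.time M N
  | .ite _ e c c' => e.size + c.time M N + c'.time M N + 2
  | .loop _ a c => extent M N a * (c.time M N + 9) + 7

/-- Code for an assignment. -/
def assignCode (v : Var) (e : Expr) : List Instr := e.code 0 ++ [.copy v.reg (stack 0)]

/-- Compilation, for a code that starts at position `l` of the program. -/
def Stmt.code : Stmt → ℕ → List Instr
  | .skip, _ => []
  | .assign v e, _ => assignCode v e
  | .store k i j e, _ =>
      addressCode k 0 (i.code 1) (j.code 2) ++ e.code 1 ++ [.store (stack 0) (stack 1)]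
  | .seq c c', l => c.code l ++ c'.code (l + c.size)
  | .ite t e c c', l =>
      e.code 0 ++ [t.instr (stack 0) (l + e.size + c'.size + 2)] ++ c'.code (l + e.size + 1) ++
        [.jump (l + e.size + c'.size + c.size + 2)] ++ c.code (l + e.size + c'.size + 2)
  | .loop v a c, l =>
      assignCode v 0 ++ (Expr.code (v - .dim a) 0 ++ [.jumpNeg (stack 0) (l + 7)]) ++
        [.jump (l + c.size + 12)] ++ c.code (l + 7) ++ (assignCode v (v + 1) ++ [.jump (l + 2)])

@[simp] theorem length_opCode (o : Op) (d : ℕ) (l l' : List Instr) :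
    (opCode o d l l').length = l.length + l'.length + 1 := by
  simp only [opCode, List.length_append, List.length_singleton]

@[simp] theorem length_addressCode (k : Arr) (d : ℕ) (l l' : List Instr) :
    (addressCode k d l l').length = l.length + l'.length + 9 := by
  simp only [addressCode, length_opCode, List.length_singleton]
  omega

@[simp] theorem Expr.length_code (e : Expr) (d : ℕ) : (e.code d).length = e.size := by
  induction e generalizing d <;>
    simp only [Expr.code, Expr.size, List.length_append, List.length_singleton, length_opCode,
      length_addressCode, *]

@[simp] theorem length_assignCode (v : Var) (e : Expr) :
    (assignCode v e).length = e.size + 1 := by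
  simp only [assignCode, List.length_append, List.length_singleton, Expr.length_code]

theorem Expr.size_sub (e e' : Expr) : (e - e').size = e.size + e'.size + 1 := rfl

@[simp] theorem Stmt.length_code (c : Stmt) (l : ℕ) : (c.code l).length = c.size := by
  induction c generalizing l <;>
    simp only [Stmt.code, Stmt.size, List.length_append, List.length_singleton, List.length_nil,
      length_addressCode, Expr.length_code, length_assignCode, Expr.size_sub, Expr.size, *] <;>
    omega

/-- The configuration `σ` represents the state `s`. -/
structure Rep (M N : ℕ) (s : State) (σ : Config) : Prop where
  dim : ∀ a : Axis, σ.reg a.reg = extent M N a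
  var : ∀ v : Var, σ.reg v.reg = s.var v
  arr : ∀ k, ∀ i < M, ∀ j < N, σ.mem (address M N k i j) = s.arr k i j

/-! ### Correctness of the compilation -/

variable {M N B d : ℕ} {P : Program} {s : State} {σ σ' : Config} {l l' : List Instr} {z z' : ℤ}

theorem Axis.reg_lt (a : Axis) : a.reg < stack 0 := by
  cases a <;> decide

theorem Var.reg_lt (v : Var) : v.reg < stack 0 := by
  cases v <;> decide

theorem Axis.reg_ne (a : Axis) (v : Var) : a.reg ≠ v.reg := by
  cases a <;> cases v <;> decide

theorem Var.reg_injective : Function.Injective Var.reg := by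
  intro v w h
  cases v <;> cases w <;> first | rfl | cases h

theorem Arr.index_injective : Function.Injective Arr.index := by
  intro k k' h
  cases k <;> cases k' <;> first | rfl | cases h

theorem Arr.index_lt (k : Arr) : k.index < 5 := by
  cases k <;> decide

theorem mul_add_inj {i i' j j' : ℕ} (hj : j < N) (hj' : j' < N)
    (h : i * N + j = i' * N + j') : i = i' ∧ j = j' := by
  have hi : i = i' := by
    simpa [Nat.mul_add_div (by omega : 0 < N), Nat.div_eq_of_lt hj, Nat.div_eq_of_lt hj', mul_comm]
      using congrArg (· / N) h
  subst hi
  exact ⟨rfl, Nat.add_left_cancel h⟩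

theorem mul_add_lt {i j : ℕ} (hi : i < M) (hj : j < N) : i * N + j < M * N := by
  have : (i + 1) * N ≤ M * N := Nat.mul_le_mul_right N hi
  rw [add_mul, one_mul] at this
  omega

theorem address_inj {k k' : Arr} {i i' j j' : ℕ} (hi : i < M) (hi' : i' < M) (hj : j < N)
    (hj' : j' < N) (h : address M N k i j = address M N k' i' j') :
    k = k' ∧ i = i' ∧ j = j' := by
  simp only [address, mul_assoc] at h
  obtain ⟨hk, h⟩ := mul_add_inj (mul_add_lt hi hj) (mul_add_lt hi' hj') h
  exact ⟨Arr.index_injective hk, mul_add_inj hj hj' h⟩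

theorem Rep.congr (h : Rep M N s σ) (hreg : ∀ r < stack 0, σ'.reg r = σ.reg r)
    (hmem : σ'.mem = σ.mem) : Rep M N s σ' where
  dim a := (hreg _ a.reg_lt).trans (h.dim a)
  var v := (hreg _ v.reg_lt).trans (h.var v)
  arr k i hi j hj := by rw [hmem, h.arr k i hi j hj]

theorem Rep.set (h : Rep M N s σ) (v : Var) (z : ℤ) :
    Rep M N (s.set v z) (σ.setReg v.reg z) where
  dim a := by simpa only [Config.setReg, Function.update_of_ne (a.reg_ne v)] using h.dim a
  var w := by
    by_cases hw : w = v
    · subst hw; simp [Config.setReg, State.set]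
    · simpa only [Config.setReg, State.set, Function.update_of_ne hw,
        Function.update_of_ne (Var.reg_injective.ne hw)] using h.var w
  arr := h.arr

theorem Rep.setArr (h : Rep M N s σ) {k : Arr} {i j : ℕ} (hi : i < M) (hj : j < N) (z : ℤ)
    (l : ℕ) : Rep M N (s.setArr k i j z)
      { σ with pc := l, mem := Function.update σ.mem (address M N k i j) z } where
  dim := h.dim
  var := h.var
  arr k' i' hi' j' hj' := by
    by_cases hc : k' = k ∧ i' = i ∧ j' = j
    · obtain ⟨rfl, rfl, rfl⟩ := hc
      simp [State.setArr]
    · have hne : address M N k' i' j' ≠ address M N k i j :=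
        fun he => hc (address_inj hi' hi hj' hj he)
      simpa only [State.setArr, if_neg hc, Function.update_of_ne hne] using
        (h.arr k' i' hi' j' hj' :)

/-- In configurations that represent `s`, the code `l` leaves the number `z` in `stack d` and
changes neither a register below that nor the memory. -/
def Evaluates (M N B : ℕ) (s : State) (l : List Instr) (d : ℕ) (z : ℤ) : Prop :=
  ∀ (P : Program) (σ : Config), σ.BoundedBy B → Rep M N s σ → CodeAt P σ.pc l →
    ∃ σ', Reach P B σ l.length σ' ∧ σ'.pc = σ.pc + l.length ∧ σ'.reg (stack d) = z ∧
      (∀ r < stack d, σ'.reg r = σ.reg r) ∧ σ'.mem = σ.mem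

theorem stack_zero_le (d : ℕ) : stack 0 ≤ stack d :=
  Nat.add_le_add_right d.zero_le 10

theorem stack_lt (d : ℕ) : stack d < stack (d + 1) :=
  Nat.add_lt_add_right d.lt_succ_self 10

theorem exec_op (σ : Config) (o : Op) (r a b : ℕ) :
    exec σ (o.instr r a b) = some (σ.setReg r (o.eval (σ.reg a) (σ.reg b))) := by
  cases o <;> rfl

theorem evaluates_singleton {I : Instr}
    (h : ∀ σ, σ.BoundedBy B → Rep M N s σ →
      exec σ I = some (σ.setReg (stack d) z) ∧ z.natAbs ≤ B) :
    Evaluates M N B s [I] d z := by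
  intro P σ hb hrep hcode
  obtain ⟨hexec, hz⟩ := h σ hb hrep
  refine ⟨_, .single hb hcode.1 hexec (hb.setReg hz _), rfl, ?_, fun r hr => ?_, rfl⟩
  · simp only [Config.setReg, Function.update_self]
  · simp only [Config.setReg, Function.update_of_ne hr.ne]

theorem evaluates_const (hz : z.natAbs ≤ B) : Evaluates M N B s [.const (stack d) z] d z :=
  evaluates_singleton fun _ _ _ => ⟨rfl, hz⟩

theorem evaluates_var (v : Var) : Evaluates M N B s [.copy (stack d) v.reg] d (s.var v) :=
  evaluates_singleton fun _ hb hrep => ⟨by rw [exec, hrep.var], hrep.var v ▸ hb.1 _⟩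

theorem evaluates_dim (a : Axis) :
    Evaluates M N B s [.copy (stack d) a.reg] d (extent M N a) :=
  evaluates_singleton fun _ hb hrep => ⟨by rw [exec, hrep.dim], hrep.dim a ▸ hb.1 _⟩

theorem Evaluates.opCode {o : Op} (h : Evaluates M N B s l d z)
    (h' : Evaluates M N B s l' (d + 1) z') (hz : (o.eval z z').natAbs ≤ B) :
    Evaluates M N B s (opCode o d l l') d (o.eval z z') := by
  intro P σ hb hrep hcode
  simp only [ArrayProgram.opCode, codeAt_append, List.length_append, ← add_assoc] at hcode
  obtain ⟨⟨hl, hl'⟩, hop⟩ := hcode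
  obtain ⟨σ₁, reach₁, pc₁, val₁, low₁, mem₁⟩ := h P σ hb hrep hl
  obtain ⟨σ₂, reach₂, pc₂, val₂, low₂, mem₂⟩ := h' P σ₁ reach₁.right
    (hrep.congr (fun r hr => low₁ r (hr.trans_le (stack_zero_le d))) mem₁) (by rwa [pc₁])
  have hexec : exec σ₂ (o.instr (stack d) (stack d) (stack (d + 1))) =
      some (σ₂.setReg (stack d) (o.eval z z')) := by
    rw [exec_op, low₂ _ (stack_lt d), val₁, val₂]
  have last : Reach P B σ₂ 1 (σ₂.setReg (stack d) (o.eval z z')) :=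
    .single reach₂.right (by rw [pc₂, pc₁]; exact hop.1) hexec (reach₂.right.setReg hz _)
  rw [length_opCode]
  refine ⟨_, (reach₁.trans reach₂).trans last, ?_, ?_, fun r hr => ?_, mem₂.trans mem₁⟩
  · simp only [Config.setReg, pc₂, pc₁, add_assoc]
  · simp only [Config.setReg, Function.update_self]
  · rw [← low₁ r hr, ← low₂ r (hr.trans (stack_lt d))]
    exact Function.update_of_ne hr.ne _ _

theorem Evaluates.load (h : Evaluates M N B s l d z) (hz : 0 ≤ z)
    (hmem : ∀ σ, Rep M N s σ → σ.mem z.toNat = z') :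
    Evaluates M N B s (l ++ [.load (stack d) (stack d)]) d z' := by
  intro P σ hb hrep hcode
  obtain ⟨hl, hload⟩ := codeAt_append.1 hcode
  obtain ⟨σ₁, reach₁, pc₁, val₁, low₁, mem₁⟩ := h P σ hb hrep hl
  have hz' : σ₁.mem z.toNat = z' := mem₁ ▸ hmem σ hrep
  have hexec : exec σ₁ (.load (stack d) (stack d)) = some (σ₁.setReg (stack d) z') := by
    rw [exec, val₁, if_pos hz, hz']
  have last : Reach P B σ₁ 1 (σ₁.setReg (stack d) z') :=
    .single reach₁.right (by rw [pc₁]; exact hload.1) hexec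
      (reach₁.right.setReg (hz' ▸ reach₁.right.2 _) _)
  rw [List.length_append, List.length_singleton]
  refine ⟨_, reach₁.trans last, ?_, ?_, fun r hr => ?_, mem₁⟩
  · simp only [Config.setReg, pc₁, add_assoc]
  · simp only [Config.setReg, Function.update_self]
  · simp only [Config.setReg, Function.update_of_ne hr.ne, low₁ r hr]

theorem address_lt {k : Arr} {i j : ℕ} (hi : i < M) (hj : j < N) :
    address M N k i j < 5 * (M * N) := by
  have h₁ := mul_add_lt hi hj
  have h₂ : k.index * (M * N) ≤ 4 * (M * N) :=
    Nat.mul_le_mul_right _ (Nat.le_of_lt_succ k.index_lt)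
  rw [address, mul_assoc]
  omega

theorem InBounds.toNat_lt (h : InBounds M N z z') : z.toNat < M ∧ z'.toNat < N := by
  obtain ⟨⟨_, _⟩, _, _⟩ := h
  omega

theorem Evaluates.addressCode {k : Arr} (hB : 5 * (M * N) ≤ B)
    (h : Evaluates M N B s l (d + 1) z) (h' : Evaluates M N B s l' (d + 2) z')
    (hz : InBounds M N z z') :
    Evaluates M N B s (addressCode k d l l') d (address M N k z.toNat z'.toNat) := by
  obtain ⟨hi, hj⟩ := hz.toNat_lt
  lift z to ℕ using hz.1.1 with i
  lift z' to ℕ using hz.2.1 with j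
  have hlt := address_lt (k := k) hi hj
  have hij := mul_add_lt hi hj
  have hk : k.index * M ≤ k.index * M * N := Nat.le_mul_of_pos_right _ (by omega)
  have hk' : k.index ≤ k.index * M := Nat.le_mul_of_pos_right _ (by omega)
  simp only [address, Int.toNat_natCast] at hlt hij ⊢
  exact ((evaluates_const (z := k.index) (by omega)).opCode (o := .mul) (evaluates_dim .rows)
    (by simp only [Op.eval, extent]; norm_cast; omega)
    |>.opCode (o := .mul) (evaluates_dim .cols) (by simp only [Op.eval, extent]; norm_cast; omega)
    |>.opCode (o := .add)
      (((h.opCode (o := .mul) (evaluates_dim .cols)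
        (by simp only [Op.eval, extent]; norm_cast; omega)).opCode
        (o := .add) h' (by simp only [Op.eval, extent]; norm_cast; omega)))
      (by simp only [Op.eval, extent]; norm_cast; omega))

theorem Expr.evaluates_code (hB : 5 * (M * N) ≤ B) (e : Expr) (h : e.Safe M N B s) :
    Evaluates M N B s (e.code d) d (e.eval M N s) := by
  induction e generalizing d with
  | const z => exact evaluates_const h
  | var v => exact evaluates_var v
  | dim a => exact evaluates_dim a
  | op o e e' ih ih' => exact (ih h.1).opCode (ih' h.2.1) h.2.2
  | entry k i j ih ih' =>
    obtain ⟨hi, hj, hij⟩ := h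
    refine ((ih hi).addressCode hB (ih' hj) hij).load (Int.natCast_nonneg _) fun σ hrep => ?_
    rw [Int.toNat_natCast, hrep.arr k _ hij.toNat_lt.1 _ hij.toNat_lt.2, Expr.eval]
  | flat p ih =>
    obtain ⟨hp, hp₀, hpMN⟩ := h
    refine (ih hp).load hp₀ fun σ hrep => ?_
    rw [Expr.eval]
    generalize p.eval M N s = z at *
    have hlt : z.toNat < N * M := by rw [mul_comm]; zify; omega
    have hN : 0 < N := Nat.pos_of_mul_pos_right ((Nat.zero_le _).trans_lt hlt)
    have := hrep.arr .io (z.toNat / N) (Nat.div_lt_of_lt_mul hlt) (z.toNat % N) (Nat.mod_lt _ hN)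
    rwa [address, Arr.index, zero_mul, zero_mul, zero_add, Nat.div_add_mod'] at this

/-- The program, run from `σ`, comes within time `T` to position `l` in a configuration that
represents a state with the property `Q`. -/
def Leads (M N B : ℕ) (P : Program) (σ : Config) (T l : ℕ) (Q : State → Prop) : Prop :=
  ∃ t s' σ', t ≤ T ∧ Reach P B σ t σ' ∧ σ'.pc = l ∧ Rep M N s' σ' ∧ Q s'

variable {Q Q' : State → Prop} {T T' p p' : ℕ} {c : Stmt} {v : Var} {a : Axis}

theorem Leads.bind (h : Leads M N B P σ T p Q)
    (h' : ∀ s' σ', σ'.BoundedBy B → σ'.pc = p → Rep M N s' σ' → Q s' →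
      Leads M N B P σ' T' p' Q') : Leads M N B P σ (T + T') p' Q' := by
  obtain ⟨t, s', σ', ht, hr, hpc, hrep, hQ⟩ := h
  obtain ⟨t', s'', σ'', ht', hr', hpc', hrep', hQ'⟩ := h' s' σ' hr.right hpc hrep hQ
  exact ⟨t + t', s'', σ'', by omega, hr.trans hr', hpc', hrep', hQ'⟩

theorem Leads.mono_time (h : Leads M N B P σ T p Q) (hT : T ≤ T') : Leads M N B P σ T' p Q := by
  obtain ⟨t, s', σ', ht, h'⟩ := h
  exact ⟨t, s', σ', ht.trans hT, h'⟩

theorem Leads.refl (hb : σ.BoundedBy B) (hpc : σ.pc = p) (hrep : Rep M N s σ) (hQ : Q s) :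
    Leads M N B P σ 0 p Q :=
  ⟨0, s, σ, le_rfl, .refl hb, hpc, hrep, hQ⟩

theorem leads_single {I : Instr} (hb : σ.BoundedBy B) (fetch : P[σ.pc]? = some I)
    (next : exec σ I = some σ') (hb' : σ'.BoundedBy B) (hpc : σ'.pc = p) (hrep : Rep M N s σ')
    (hQ : Q s) : Leads M N B P σ 1 p Q :=
  ⟨1, s, σ', le_rfl, .single hb fetch next hb', hpc, hrep, hQ⟩

theorem leads_jump (hb : σ.BoundedBy B) (fetch : P[σ.pc]? = some (.jump p)) (hrep : Rep M N s σ)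
    (hQ : Q s) : Leads M N B P σ 1 p Q :=
  leads_single (σ' := { σ with pc := p }) hb fetch rfl ⟨hb.1, hb.2⟩ rfl
    ⟨hrep.dim, hrep.var, hrep.arr⟩ hQ

theorem Evaluates.leads (h : Evaluates M N B s l 0 z) (hb : σ.BoundedBy B) (hrep : Rep M N s σ)
    (hcode : CodeAt P σ.pc l)
    (h' : ∀ σ', σ'.BoundedBy B → σ'.pc = σ.pc + l.length → Rep M N s σ' →
      σ'.reg (stack 0) = z → Leads M N B P σ' T p Q) :
    Leads M N B P σ (l.length + T) p Q := by
  obtain ⟨σ', hr, hpc, hz, hlow, hmem⟩ := h P σ hb hrep hcode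
  obtain ⟨t, s', σ'', ht, hr', h''⟩ := h' σ' hr.right hpc (hrep.congr hlow hmem) hz
  exact ⟨l.length + t, s', σ'', by omega, hr.trans hr', h''⟩

theorem leads_assign {e : Expr} (hB : 5 * (M * N) ≤ B)
    (hcode : CodeAt P p (assignCode v e)) (hb : σ.BoundedBy B) (hrep : Rep M N s σ)
    (hpc : σ.pc = p) (he : e.Safe M N B s) (hQ : Q (s.set v (e.eval M N s))) :
    Leads M N B P σ (e.size + 1) (p + e.size + 1) Q := by
  subst hpc
  obtain ⟨heval, hcopy⟩ := codeAt_append.1 hcode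
  rw [← e.length_code 0] at *
  refine (e.evaluates_code hB he).leads hb hrep heval fun σ' hb' hpc' hrep' hz => ?_
  have hexec : exec σ' (.copy v.reg (stack 0)) = some (σ'.setReg v.reg (e.eval M N s)) := by
    rw [exec, hz]
  exact leads_single hb' (by rw [hpc']; exact hcopy.1) hexec (hb'.setReg (hz ▸ hb'.1 _) _)
    (by simp only [Config.setReg, hpc']) (hrep'.set v _) hQ

theorem leads_store {k : Arr} {i j e : Expr} (hB : 5 * (M * N) ≤ B)
    (hcode : CodeAt P p (Stmt.code (.store k i j e) p)) (hb : σ.BoundedBy B) (hrep : Rep M N s σ)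
    (hpc : σ.pc = p) (h : wp M N B (.store k i j e) Q s) :
    Leads M N B P σ (i.size + j.size + e.size + 10) (p + (i.size + j.size + e.size + 10)) Q := by
  subst hpc
  obtain ⟨⟨hi, hj, hij⟩, he, hQ⟩ := h
  simp only [Stmt.code, codeAt_append, length_addressCode, Expr.length_code,
    List.length_append] at hcode
  obtain ⟨⟨hcode₁, hcode₂⟩, hstore⟩ := hcode
  obtain ⟨σ₁, reach₁, pc₁, val₁, low₁, mem₁⟩ := (i.evaluates_code hB hi).addressCode
    (k := k) hB (j.evaluates_code hB hj) hij P σ hb hrep hcode₁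
  have hrep₁ := hrep.congr low₁ mem₁
  rw [length_addressCode, Expr.length_code, Expr.length_code] at reach₁ pc₁
  obtain ⟨σ₂, reach₂, pc₂, val₂, low₂, mem₂⟩ :=
    e.evaluates_code hB he P σ₁ reach₁.right hrep₁ (by rwa [pc₁])
  rw [Expr.length_code] at reach₂ pc₂
  have hexec : exec σ₂ (.store (stack 0) (stack 1)) =
      some { σ₂ with
        pc := σ₂.pc + 1
        mem := Function.update σ₂.mem (address M N k (i.eval M N s).toNat (j.eval M N s).toNat)
          (e.eval M N s) } := by
    rw [exec, low₂ _ (stack_lt 0), val₁, val₂, if_pos (Int.natCast_nonneg _), Int.toNat_natCast]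
  refine ⟨_, _, _, ?_, (reach₁.trans reach₂).trans
    (.single reach₂.right (by rw [pc₂, pc₁, ← hstore.1]; congr 1; omega) hexec
      (reach₂.right.setMem (val₂ ▸ reach₂.right.1 _) _ _)), ?_,
    (hrep₁.congr (fun r hr => low₂ r (hr.trans (stack_lt 0))) mem₂).setArr
      hij.toNat_lt.1 hij.toNat_lt.2 _ _, hQ⟩
  · omega
  · simp only [pc₂, pc₁]; omega

theorem leads_test {t : Test} {e : Expr} (hB : 5 * (M * N) ≤ B) {q : ℕ}
    (hcode : CodeAt P p (e.code 0 ++ [t.instr (stack 0) q])) (hb : σ.BoundedBy B)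
    (hrep : Rep M N s σ) (hpc : σ.pc = p) (he : e.Safe M N B s)
    (hp' : t.Holds (e.eval M N s) ∧ p' = q ∨ ¬ t.Holds (e.eval M N s) ∧ p' = p + e.size + 1)
    (hQ : Q s) : Leads M N B P σ (e.size + 1) p' Q := by
  subst hpc
  obtain ⟨heval, htest⟩ := codeAt_append.1 hcode
  rw [← e.length_code 0] at *
  refine (e.evaluates_code hB he).leads hb hrep heval fun σ' hb' hpc' hrep' hz => ?_
  have hexec : exec σ' (t.instr (stack 0) q) = some { σ' with pc := p' } := by
    rcases hp' with ⟨h, rfl⟩ | ⟨h, rfl⟩ <;> cases t <;> simp only [Test.Holds] at h <;>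
      simp [Test.instr, exec, hz, h, hpc']
  exact leads_single hb' (by rw [hpc']; exact htest.1) hexec ⟨hb'.1, hb'.2⟩ rfl
    ⟨hrep'.dim, hrep'.var, hrep'.arr⟩ hQ

theorem extent_le (hM : 0 < M) (hN : 0 < N) (a : Axis) : extent M N a ≤ M * N := by
  cases a
  · exact Nat.le_mul_of_pos_right M hN
  · exact Nat.le_mul_of_pos_left N hM

theorem leads_loopTest (hB : 5 * (M * N) ≤ B) (hext : extent M N a ≤ M * N)
    (hcode : CodeAt P p (Expr.code (v - .dim a) 0 ++ [.jumpNeg (stack 0) (p + 5)])) {k : ℕ}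
    (hb : σ.BoundedBy B) (hrep : Rep M N s σ) (hpc : σ.pc = p) (hk : s.var v = k)
    (hkn : k ≤ extent M N a) (hQ : Q s) :
    Leads M N B P σ 4 (if k < extent M N a then p + 5 else p + 4) Q := by
  have heval : Expr.eval M N s (v - .dim a) = k - extent M N a := by
    rw [← hk]; rfl
  refine leads_test (t := .neg) (e := v - .dim a) hB hcode hb hrep hpc ?_ ?_ hQ
  · refine ⟨trivial, trivial, ?_⟩
    change (Expr.eval M N s (v - .dim a)).natAbs ≤ B
    omega
  · simp only [heval, Test.Holds]
    split_ifs with h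
    · exact .inl ⟨by omega, rfl⟩
    · exact .inr ⟨by omega, rfl⟩

theorem leads_loopStep (hB : 5 * (M * N) ≤ B) {q k : ℕ} (hk : k < M * N)
    (hcode : CodeAt P p (assignCode v (v + 1) ++ [.jump q])) (hb : σ.BoundedBy B)
    (hrep : Rep M N s σ) (hpc : σ.pc = p) (hv : s.var v = k) (hQ : Q (s.set v (k + 1))) :
    Leads M N B P σ 5 q Q := by
  obtain ⟨hassign, hjump⟩ := codeAt_append.1 hcode
  have heval : Expr.eval M N s (v + 1) = k + 1 := by
    rw [← hv]; rfl
  have hsafe : Expr.Safe M N B s (v + 1) := by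
    refine ⟨trivial, ?_, ?_⟩
    · change (1 : ℤ).natAbs ≤ B
      omega
    · change (Expr.eval M N s (v + 1)).natAbs ≤ B
      omega
  refine (leads_assign (Q := Q) hB hassign hb hrep hpc hsafe (by rwa [heval])).bind (T' := 1)
    fun s' σ' hb' hpc' hrep' hQ' => leads_jump hb' ?_ hrep' hQ'
  rw [hpc', ← hjump.1, length_assignCode]
  rfl

theorem codeAt_loop (h : CodeAt P p (Stmt.code (.loop v a c) p)) :
    CodeAt P p (assignCode v 0) ∧
      CodeAt P (p + 2) (Expr.code (v - .dim a) 0 ++ [.jumpNeg (stack 0) (p + 7)]) ∧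
      P[p + 6]? = some (.jump (p + c.size + 12)) ∧ CodeAt P (p + 7) (c.code (p + 7)) ∧
      CodeAt P (p + 7 + c.size) (assignCode v (v + 1) ++ [.jump (p + 2)]) := by
  rw [Stmt.code, codeAt_append, codeAt_append, codeAt_append, codeAt_append] at h
  simp only [List.length_append, List.length_singleton, length_assignCode, Expr.length_code,
    Stmt.length_code, Expr.size_sub, Expr.size] at h
  obtain ⟨⟨⟨⟨hinit, htest⟩, hexit, -⟩, hbody⟩, hstep⟩ := h
  exact ⟨hinit, htest, hexit, hbody, by convert hstep using 1; omega⟩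

theorem leads_of_wpIter (hB : 5 * (M * N) ≤ B) (hext : extent M N a ≤ M * N)
    (hcode : CodeAt P p (Stmt.code (.loop v a c) p))
    (ih : ∀ (Q : State → Prop) (s : State) (σ : Config), σ.BoundedBy B → Rep M N s σ →
      σ.pc = p + 7 → wp M N B c Q s → Leads M N B P σ (c.time M N) (p + 7 + c.size) Q)
    {n k : ℕ} (hn : k + n = extent M N a) (hb : σ.BoundedBy B) (hrep : Rep M N s σ)
    (hpc : σ.pc = p + 2) (hk : s.var v = k) (h : wpIter (wp M N B c) v Q n k s) :
    Leads M N B P σ (n * (c.time M N + 9) + 5) (p + c.size + 12) Q := by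
  obtain ⟨-, htest, hexit, -, hstep⟩ := codeAt_loop hcode
  induction n generalizing k s σ with
  | zero =>
    have test := leads_loopTest (Q := Q) hB hext htest hb hrep hpc hk (by omega) h
    rw [if_neg (by omega)] at test
    refine (test.bind (T' := 1) fun s' σ' hb' hpc' hrep' hQ => ?_).mono_time (by omega)
    exact leads_jump hb' (by rw [hpc', ← hexit]) hrep' hQ
  | succ n IH =>
    have test := leads_loopTest (Q := (· = s)) hB hext htest hb hrep hpc hk (by omega) rfl
    rw [if_pos (by omega)] at test
    refine (test.bind (T' := c.time M N + (5 + (n * (c.time M N + 9) + 5)))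
      fun s₁ σ₁ hb₁ hpc₁ hrep₁ hs₁ => ?_).mono_time (by rw [add_mul]; omega)
    subst hs₁
    refine (ih _ s₁ σ₁ hb₁ hrep₁ hpc₁ h).bind fun s₂ σ₂ hb₂ hpc₂ hrep₂ hs₂ => ?_
    refine (leads_loopStep (Q := fun s' => s'.var v = (k + 1 : ℕ) ∧ _) hB (by omega) hstep hb₂ hrep₂
      hpc₂ hs₂.1 ⟨by simp [State.set], hs₂.2⟩).bind fun s₃ σ₃ hb₃ hpc₃ hrep₃ hs₃ => ?_
    exact IH (by omega) hb₃ hrep₃ hpc₃ hs₃.1 hs₃.2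

theorem leads_ite {t : Test} {e : Expr} {c' : Stmt} (hB : 5 * (M * N) ≤ B)
    (hcode : CodeAt P p (Stmt.code (.ite t e c c') p))
    (ih : ∀ p' σ', CodeAt P p' (c.code p') → σ'.BoundedBy B → Rep M N s σ' → σ'.pc = p' →
      wp M N B c Q s → Leads M N B P σ' (c.time M N) (p' + c.size) Q)
    (ih' : ∀ p' σ', CodeAt P p' (c'.code p') → σ'.BoundedBy B → Rep M N s σ' → σ'.pc = p' →
      wp M N B c' Q s → Leads M N B P σ' (c'.time M N) (p' + c'.size) Q)
    (hb : σ.BoundedBy B) (hrep : Rep M N s σ) (hpc : σ.pc = p)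
    (h : wp M N B (.ite t e c c') Q s) :
    Leads M N B P σ (Stmt.time M N (.ite t e c c')) (p + Stmt.size (.ite t e c c')) Q := by
  rw [Stmt.code, codeAt_append, codeAt_append, codeAt_append] at hcode
  simp only [List.length_append, List.length_singleton, Expr.length_code,
    Stmt.length_code] at hcode
  obtain ⟨⟨⟨htest, helse⟩, hjump, -⟩, hthen⟩ := hcode
  obtain ⟨he, hpos, hneg⟩ := h
  simp only [Stmt.time, Stmt.size]
  by_cases ht : t.Holds (e.eval M N s)
  · refine ((leads_test (Q := (· = s)) hB htest hb hrep hpc he (.inl ⟨ht, rfl⟩) rfl).bind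
      (T' := c.time M N) fun s' σ' hb' hpc' hrep' hs => ?_).mono_time (by omega)
    subst hs
    convert ih _ σ' (by convert hthen using 1; omega) hb' hrep' hpc' (hpos ht) using 1
    omega
  · refine ((leads_test (Q := (· = s)) hB htest hb hrep hpc he (.inr ⟨ht, rfl⟩) rfl).bind
      (T' := c'.time M N + 1) fun s' σ' hb' hpc' hrep' hs => ?_).mono_time (by omega)
    subst hs
    refine (ih' _ σ' (by rwa [← add_assoc] at helse) hb' hrep' hpc' (hneg ht)).bind
      fun s₁ σ₁ hb₁ hpc₁ hrep₁ hQ => leads_jump hb₁ ?_ hrep₁ hQ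
    rw [hpc₁]
    convert hjump using 2 <;> first | omega | (congr 1; omega)

theorem leads_of_wp (hB : 5 * (M * N) ≤ B) (hM : 0 < M) (hN : 0 < N) (c : Stmt)
    (hcode : CodeAt P p (c.code p)) (hb : σ.BoundedBy B) (hrep : Rep M N s σ)
    (hpc : σ.pc = p) (h : wp M N B c Q s) :
    Leads M N B P σ (c.time M N) (p + c.size) Q := by
  induction c generalizing Q s σ p with
  | skip => exact .refl hb hpc hrep h
  | assign v e => exact leads_assign hB hcode hb hrep hpc h.1 h.2
  | store k i j e => exact leads_store hB hcode hb hrep hpc h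
  | seq c c' ih ih' =>
    rw [Stmt.code, codeAt_append, Stmt.length_code] at hcode
    rw [Stmt.size, ← add_assoc]
    exact (ih hcode.1 hb hrep hpc h).bind fun s' σ' hb' hpc' hrep' hQ' =>
      ih' hcode.2 hb' hrep' hpc' hQ'
  | ite t e c c' ih ih' =>
    exact leads_ite hB hcode (fun _ _ hcode hb hrep hpc h => ih hcode hb hrep hpc h)
      (fun _ _ hcode hb hrep hpc h => ih' hcode hb hrep hpc h) hb hrep hpc h
  | loop v a c ih =>
    obtain ⟨hinit, -, -, hbody, -⟩ := codeAt_loop hcode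
    refine ((leads_assign (Q := (· = s.set v 0)) hB hinit hb hrep hpc (Nat.zero_le B) rfl).bind
      (T' := extent M N a * (c.time M N + 9) + 5)
      fun s' σ' hb' hpc' hrep' hs => ?_).mono_time (by simp only [Stmt.time, Expr.size]; omega)
    subst hs
    exact leads_of_wpIter hB (extent_le hM hN a) hcode
      (fun Q s σ hb hrep hpc h => ih hbody hb hrep hpc h) (Nat.zero_add _) hb' hrep' hpc'
      (by simp [State.set]) h

end ArrayProgram

/-! ### Program logic -/

namespace ArrayProgram

open RAM WindowSum

/-- The variables that a statement may change. -/
def Stmt.writes : Stmt → List Var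
  | .assign v _ => [v]
  | .seq c c' | .ite _ _ c c' => c.writes ++ c'.writes
  | .loop v _ c => v :: c.writes
  | _ => []

/-- The arrays that a statement may change. -/
def Stmt.stores : Stmt → List Arr
  | .store k _ _ _ => [k]
  | .seq c c' | .ite _ _ c c' => c.stores ++ c'.stores
  | .loop _ _ c => c.stores
  | _ => []

/-- The states `s` and `s'` agree in everything that `c` cannot change. -/
structure Frame (c : Stmt) (s s' : State) : Prop where
  var : ∀ v ∉ c.writes, s'.var v = s.var v
  arr : ∀ k ∉ c.stores, s'.arr k = s.arr k

variable {M N B : ℕ} {s s' s'' : State} {c c' : Stmt} {Q Q' : State → Prop} {v w : Var} {a : Axis}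
  {e e' : Expr}

@[simp] theorem State.set_var (z : ℤ) : (s.set v z).var w = if w = v then z else s.var w := by
  simp only [State.set, Function.update_apply]

@[simp] theorem State.set_arr (z : ℤ) : (s.set v z).arr = s.arr := rfl

@[simp] theorem State.setArr_var (k : Arr) (i j : ℕ) (z : ℤ) : (s.setArr k i j z).var = s.var := rfl

@[simp] theorem State.setArr_arr (k k' : Arr) (i j i' j' : ℕ) (z : ℤ) :
    (s.setArr k i j z).arr k' i' j' =
      if k' = k ∧ i' = i ∧ j' = j then z else s.arr k' i' j' := rfl

@[simp] theorem Expr.eval_add : (e + e').eval M N s = e.eval M N s + e'.eval M N s := rfl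

@[simp] theorem Expr.eval_sub : (e - e').eval M N s = e.eval M N s - e'.eval M N s := rfl

@[simp] theorem Expr.eval_mul : (e * e').eval M N s = e.eval M N s * e'.eval M N s := rfl

@[simp] theorem Expr.eval_ofNat (n : ℕ) :
    Expr.eval M N s (no_index (OfNat.ofNat n)) = (OfNat.ofNat n : ℤ) := rfl

@[simp] theorem Expr.safe_sub : (e - e').Safe M N B s ↔
    e.Safe M N B s ∧ e'.Safe M N B s ∧ (e.eval M N s - e'.eval M N s).natAbs ≤ B := Iff.rfl

@[simp] theorem Expr.safe_ofNat (n : ℕ) :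
    Expr.Safe M N B s (no_index (OfNat.ofNat n)) ↔ n ≤ B := Iff.rfl

theorem Frame.refl (c : Stmt) (s : State) : Frame c s s := ⟨fun _ _ => rfl, fun _ _ => rfl⟩

theorem Frame.trans (h : Frame c s s') (h' : Frame c s' s'') : Frame c s s'' :=
  ⟨fun v hv => (h'.var v hv).trans (h.var v hv), fun k hk => (h'.arr k hk).trans (h.arr k hk)⟩

theorem Frame.mono (h : Frame c s s') (hw : c.writes ⊆ c'.writes) (hs : c.stores ⊆ c'.stores) :
    Frame c' s s' :=
  ⟨fun v hv => h.var v fun h => hv (hw h), fun k hk => h.arr k fun h => hk (hs h)⟩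

theorem Frame.set (h : Frame c s s') (hv : v ∈ c.writes) (z : ℤ) : Frame c s (s'.set v z) :=
  ⟨fun w hw => by rw [State.set_var, if_neg (ne_of_mem_of_not_mem hv hw).symm, h.var w hw], h.arr⟩

theorem Frame.assign (v : Var) (e : Expr) {z : ℤ} : Frame (v ::= e) s (s.set v z) :=
  (Frame.refl _ _).set (List.mem_singleton_self v) z

theorem Frame.seq_left (h : Frame c s s') : Frame (c ;; c') s s' :=
  h.mono (List.subset_append_left _ _) (List.subset_append_left _ _)

theorem Frame.seq_right (h : Frame c' s s') : Frame (c ;; c') s s' :=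
  h.mono (List.subset_append_right _ _) (List.subset_append_right _ _)

theorem Frame.loop (h : Frame c s s') : Frame (.loop v a c) s s' :=
  h.mono (List.subset_cons_self _ _) (List.Subset.refl _)

theorem wpIter_mono {body : (State → Prop) → State → Prop}
    (hbody : ∀ (Q Q' : State → Prop) s, (∀ s', Q s' → Q' s') → body Q s → body Q' s)
    (hQ : ∀ s, Q s → Q' s) {n k : ℕ} (h : wpIter body v Q n k s) : wpIter body v Q' n k s := by
  induction n generalizing k s with
  | zero => exact hQ _ h
  | succ n ih => exact hbody _ _ _ (fun s' h' => ⟨h'.1, ih h'.2⟩) h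

theorem wp_mono (hQ : ∀ s, Q s → Q' s) (h : wp M N B c Q s) : wp M N B c Q' s := by
  induction c generalizing Q Q' s with
  | skip => exact hQ _ h
  | assign => exact ⟨h.1, hQ _ h.2⟩
  | store => exact ⟨h.1, h.2.1, hQ _ h.2.2⟩
  | seq c c' ih ih' => exact ih (fun s => ih' hQ) h
  | ite t e c c' ih ih' => exact ⟨h.1, fun ht => ih hQ (h.2.1 ht), fun ht => ih' hQ (h.2.2 ht)⟩
  | loop v a c ih => exact wpIter_mono (body := wp M N B c) (fun _ _ _ hQ h => ih hQ h) hQ h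

theorem wpIter_frame (ih : ∀ {Q : State → Prop} {s : State}, wp M N B c Q s →
      wp M N B c (fun s' => Q s' ∧ Frame c s s') s) {n k : ℕ}
    (hf : Frame (.loop v a c) s s') (h : wpIter (wp M N B c) v Q n k s') :
    wpIter (wp M N B c) v (fun s' => Q s' ∧ Frame (.loop v a c) s s') n k s' := by
  induction n generalizing k s' with
  | zero => exact ⟨h, hf⟩
  | succ n IH =>
    exact wp_mono (fun s'' ⟨⟨hk, h''⟩, hf'⟩ =>
      ⟨hk, IH ((hf.trans hf'.loop).set List.mem_cons_self _) h''⟩) (ih h)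

theorem wp_frame (h : wp M N B c Q s) : wp M N B c (fun s' => Q s' ∧ Frame c s s') s := by
  induction c generalizing Q s with
  | skip => exact ⟨h, .refl _ _⟩
  | assign v e => exact ⟨h.1, h.2, .assign v e⟩
  | store k i j e =>
    refine ⟨h.1, h.2.1, h.2.2, fun _ _ => rfl, fun k' hk' => ?_⟩
    have hne : k' ≠ k := fun he => hk' (List.mem_singleton.2 he)
    funext i' j'
    rw [State.setArr_arr, if_neg fun h => hne h.1]
  | seq c c' ih ih' =>
    refine wp_mono (c := c) (fun s' ⟨h', hf⟩ => ?_) (ih h)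
    exact wp_mono (fun s'' ⟨hQ, hf'⟩ => ⟨hQ, hf.seq_left.trans hf'.seq_right⟩) (ih' h')
  | ite t e c c' ih ih' =>
    exact ⟨h.1, fun ht => wp_mono (fun _ h => ⟨h.1, h.2.mono (List.subset_append_left _ _)
        (List.subset_append_left _ _)⟩) (ih (h.2.1 ht)),
      fun ht => wp_mono (fun _ h => ⟨h.1, h.2.mono (List.subset_append_right _ _)
        (List.subset_append_right _ _)⟩) (ih' (h.2.2 ht))⟩
  | loop v a c ih => exact wpIter_frame ih ((Frame.refl _ _).set List.mem_cons_self 0) h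

theorem wp_framed (h : wp M N B c (fun s' => Frame c s s' → Q s') s) : wp M N B c Q s :=
  wp_mono (fun _ h => h.1 h.2) (wp_frame h)

theorem wp_seq (h : wp M N B c (wp M N B c' Q) s) : wp M N B (c ;; c') Q s := h

theorem wpIter_of_invariant (Inv : ℕ → State → Prop) (hv : v ∉ c.writes)
    (step : ∀ k < extent M N a, ∀ s', Frame (.loop v a c) s s' → s'.var v = k → Inv k s' →
      wp M N B c (fun s'' => Inv (k + 1) (s''.set v ((k : ℤ) + 1))) s')
    {n k : ℕ} (hn : k + n = extent M N a) (hf : Frame (.loop v a c) s s') (hk : s'.var v = k)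
    (hI : Inv k s') :
    wpIter (wp M N B c) v (fun s' => Frame (.loop v a c) s s' ∧ Inv (extent M N a) s') n k s' := by
  induction n generalizing k s' with
  | zero => exact ⟨hf, hn ▸ hI⟩
  | succ n ih =>
    refine wp_mono ?_ (wp_frame (step k (by omega) s' hf hk hI))
    rintro s'' ⟨h'', hf'⟩
    refine ⟨by rw [hf'.var v hv, hk], ih (by omega) ?_ (by simp) h''⟩
    exact (hf.trans hf'.loop).set List.mem_cons_self _

theorem wp_loop (Inv : ℕ → State → Prop) (hv : v ∉ c.writes) (start : Inv 0 (s.set v 0))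
    (step : ∀ k < extent M N a, ∀ s', Frame (.loop v a c) s s' → s'.var v = k → Inv k s' →
      wp M N B c (fun s'' => Inv (k + 1) (s''.set v ((k : ℤ) + 1))) s')
    (post : ∀ s', Frame (.loop v a c) s s' → Inv (extent M N a) s' → Q s') :
    wp M N B (.loop v a c) Q s :=
  wpIter_mono (body := wp M N B c) (fun _ _ _ => wp_mono) (fun s' h => post s' h.1 h.2)
    (wpIter_of_invariant Inv hv step (Nat.zero_add _)
      ((Frame.refl _ _).set List.mem_cons_self 0) (by simp) start)

/-! ### Minima, vectors and sweeps -/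

/-- Replace the value of `best` by `e` if `e` is smaller. -/
def takeMin (e : Expr) : Stmt := .ite .neg (e - Var.best) (.best ::= e) .skip

/-- Replace the value of `best` by the minimum of it and of the numbers `e'` over all rounds of
the loop in which `e` passes the test. -/
def minLoop (v : Var) (a : Axis) (t : Test) (e e' : Expr) : Stmt :=
  .loop v a (.ite t e (takeMin e') .skip)

theorem wp_takeMin (he : e.Safe M N B s) (hB : (e.eval M N s - s.var .best).natAbs ≤ B)
    (hQ : Q (s.set .best (min (e.eval M N s) (s.var .best)))) : wp M N B (takeMin e) Q s := by
  refine ⟨⟨he, trivial, hB⟩, fun hneg => ⟨he, ?_⟩, fun hneg => ?_⟩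
  · rwa [min_eq_left (by simp only [Test.Holds, Expr.eval_sub, Expr.eval] at hneg; omega)] at hQ
  · rw [min_eq_right (by simp only [Test.Holds, Expr.eval_sub, Expr.eval] at hneg; omega)] at hQ
    simpa only [wp, State.set, Function.update_eq_self] using hQ

theorem wp_minLoop {t : Test} {p : ℕ → Prop} {f : ℕ → ℤ} {L : ℕ} (hv : v ≠ .best)
    (hL : 2 * L ≤ B) (hb : (s.var .best).natAbs ≤ L)
    (hf : ∀ k < extent M N a, (f k).natAbs ≤ L)
    (h : ∀ k < extent M N a, ∀ s', Frame (minLoop v a t e e') s s' → s'.var v = k →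
      (e.Safe M N B s' ∧ (t.Holds (e.eval M N s') ↔ p k)) ∧
        e'.Safe M N B s' ∧ e'.eval M N s' = f k)
    (post : ∀ s', Frame (minLoop v a t e e') s s' →
      s'.var .best = minWhere (extent M N a) p (s.var .best) f → Q s') :
    wp M N B (minLoop v a t e e') Q s := by
  classical
  refine wp_loop (fun k s' => s'.var .best = minWhere k p (s.var .best) f) ?_ ?_ ?_ post
  · simpa [takeMin, Stmt.writes] using hv
  · simp [hv.symm, minWhere]
  · intro k hk s' hs' hvk hbest
    obtain ⟨⟨hsafe, htest⟩, hsafe', heval⟩ := h k hk s' hs' hvk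
    have hf' := hf k hk
    have hmin : (minWhere k p (s.var .best) f).natAbs ≤ L :=
      natAbs_minWhere_le hb fun k' hk' => hf k' (hk'.trans hk)
    refine ⟨hsafe, fun ht => wp_takeMin hsafe' (by rw [heval, hbest]; omega) ?_, fun ht => ?_⟩
    · simp [hv.symm, minWhere_succ, htest.1 ht, heval, hbest]
    · simpa [wp, hv.symm, minWhere_succ, mt htest.2 ht] using hbest

/-- The variable that runs over the indices of an axis. -/
def Axis.counter : Axis → Var
  | .rows => .row
  | .cols => .col

/-- Assignment to the entry of a vector at the position given by the counter of the axis. A vector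
of one entry per row occupies the first column of its array, and a vector of one entry per column
the first row. -/
def Axis.put : Axis → Arr → Expr → Stmt
  | .rows, k, e => .store k Var.row 0 e
  | .cols, k, e => .store k 0 Var.col e

/-- The entry of a vector at the position given by the counter of the axis. -/
def Axis.get : Axis → Arr → Expr
  | .rows, k => .entry k Var.row 0
  | .cols, k => .entry k 0 Var.col

/-- The entries of a vector. -/
def State.vec (s : State) : Axis → Arr → ℕ → ℤ
  | .rows, k, i => s.arr k i 0
  | .cols, k, j => s.arr k 0 j

/-- The array `k` holds the vector `f`. -/
def HasVec (M N : ℕ) (s : State) (a : Axis) (k : Arr) (f : ℕ → ℤ) : Prop :=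
  ∀ i < extent M N a, s.vec a k i = f i

/-- The array `k` holds the matrix `W`. -/
def HasTable (M N : ℕ) (s : State) (k : Arr) (W : ℕ → ℕ → ℤ) : Prop :=
  ∀ i < M, ∀ j < N, s.arr k i j = W i j

/-- Store in the vector `k` the values of `best` that the body produces. -/
def tabulate (a : Axis) (k : Arr) (c : Stmt) : Stmt := .loop a.counter a (c ;; a.put k Var.best)

theorem wp_put {k : Arr} {i : ℕ} (hM : 0 < M) (hN : 0 < N) (hi : i < extent M N a)
    (hcounter : s.var a.counter = i) (he : e.Safe M N B s)
    (hQ : ∀ s', s'.var = s.var →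
      (∀ i', s'.vec a k i' = if i' = i then e.eval M N s else s.vec a k i') → Q s') :
    wp M N B (a.put k e) Q s := by
  cases a with
  | rows =>
    simp only [Axis.counter, extent] at hcounter hi
    refine ⟨⟨trivial, B.zero_le, ?_⟩, he, hQ _ rfl fun i' => ?_⟩
    · simp [InBounds, Expr.eval, hcounter, hi, hN]
    · simp [State.vec, Expr.eval, hcounter]
  | cols =>
    simp only [Axis.counter, extent] at hcounter hi
    refine ⟨⟨B.zero_le, trivial, ?_⟩, he, hQ _ rfl fun i' => ?_⟩
    · simp [InBounds, Expr.eval, hcounter, hi, hM]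
    · simp [State.vec, Expr.eval, hcounter]

theorem safe_get {k : Arr} {i : ℕ} (hM : 0 < M) (hN : 0 < N) (hi : i < extent M N a)
    (hcounter : s.var a.counter = i) : (a.get k).Safe M N B s := by
  cases a with
  | rows =>
    simp only [Axis.counter, extent] at hcounter hi
    simp [Axis.get, Expr.Safe, InBounds, Expr.eval, hcounter, hi, hN]
  | cols =>
    simp only [Axis.counter, extent] at hcounter hi
    simp [Axis.get, Expr.Safe, InBounds, Expr.eval, hcounter, hi, hM]

theorem eval_get {k : Arr} {i : ℕ} (hcounter : s.var a.counter = i) :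
    (a.get k).eval M N s = s.vec a k i := by
  cases a <;> simp_all [Axis.get, Expr.eval, Axis.counter, State.vec]

theorem Frame.vec {k : Arr} (h : Frame c s s') (hk : k ∉ c.stores) (i : ℕ) :
    s'.vec a k i = s.vec a k i := by
  cases a <;> simp only [State.vec, h.arr k hk]

theorem HasVec.frame {k : Arr} {f : ℕ → ℤ} (h : HasVec M N s a k f) (hf : Frame c s s')
    (hk : k ∉ c.stores) : HasVec M N s' a k f :=
  fun i hi => (hf.vec hk i).trans (h i hi)

theorem HasTable.frame {k : Arr} {W : ℕ → ℕ → ℤ} (h : HasTable M N s k W) (hf : Frame c s s')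
    (hk : k ∉ c.stores) : HasTable M N s' k W :=
  fun i hi j hj => by rw [hf.arr k hk, h i hi j hj]

theorem wp_tabulate {k : Arr} {f : ℕ → ℤ} (hM : 0 < M) (hN : 0 < N) (hk : k ∉ c.stores)
    (hc : a.counter ∉ c.writes)
    (h : ∀ i < extent M N a, ∀ s', Frame (tabulate a k c) s s' → s'.var a.counter = i →
      wp M N B c (fun s'' => s''.var .best = f i) s')
    (post : ∀ s', Frame (tabulate a k c) s s' → HasVec M N s' a k f → Q s') :
    wp M N B (tabulate a k c) Q s := by
  refine wp_loop (fun i s' => ∀ i' < i, s'.vec a k i' = f i') ?_ (by simp) ?_ post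
  · cases a <;> simpa [Stmt.writes, Axis.put] using hc
  · intro i hi s' hs' hcounter hvec
    refine wp_mono (c := c) (fun s'' ⟨hbest, hs''⟩ => ?_) (wp_frame (h i hi s' hs' hcounter))
    refine wp_put hM hN hi (by rw [hs''.var _ hc, hcounter]) trivial fun t _ ht i' hi' => ?_
    have hset : ∀ z, (t.set a.counter z).vec a k i' = t.vec a k i' := by
      cases a <;> simp [State.vec]
    rw [hset, ht]
    split_ifs with hii
    · rw [hii]; exact hbest
    · rw [hs''.vec hk, hvec i' (by omega)]

/-- Store in the vector `k` the minima that a loop along the axis `b` produces from the initial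
values computed by `c`. -/
def tabulateMin (a : Axis) (k : Arr) (c : Stmt) (v : Var) (b : Axis) (t : Test) (e e' : Expr) :
    Stmt :=
  tabulate a k (c ;; minLoop v b t e e')

theorem wp_tabulateMin {k : Arr} {b : Axis} {t : Test} {p : ℕ → ℕ → Prop} {g : ℕ → ℤ}
    {f : ℕ → ℕ → ℤ} {L : ℕ} (hM : 0 < M) (hN : 0 < N) (hv : v ≠ .best) (hva : v ≠ a.counter)
    (hk : k ∉ c.stores) (hc : a.counter ∉ c.writes) (hL : 2 * L ≤ B)
    (hg : ∀ i < extent M N a, (g i).natAbs ≤ L)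
    (hf : ∀ i < extent M N a, ∀ j < extent M N b, (f i j).natAbs ≤ L)
    (init : ∀ i < extent M N a, ∀ s', Frame (tabulateMin a k c v b t e e') s s' →
      s'.var a.counter = i → wp M N B c (fun s'' => s''.var .best = g i) s')
    (h : ∀ i < extent M N a, ∀ j < extent M N b, ∀ s',
      Frame (tabulateMin a k c v b t e e') s s' → s'.var a.counter = i → s'.var v = j →
      (e.Safe M N B s' ∧ (t.Holds (e.eval M N s') ↔ p i j)) ∧
        e'.Safe M N B s' ∧ e'.eval M N s' = f i j)
    (post : ∀ s', Frame (tabulateMin a k c v b t e e') s s' →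
      HasVec M N s' a k (fun i => minWhere (extent M N b) (p i) (g i) (f i)) → Q s') :
    wp M N B (tabulateMin a k c v b t e e') Q s := by
  have hcounter : a.counter ∉ (minLoop v b t e e').writes := by
    cases a <;> simpa [minLoop, takeMin, Stmt.writes, Axis.counter] using hva.symm
  refine wp_tabulate hM hN ?_ ?_ (fun i hi s₁ hs₁ hi₁ => ?_) post
  · simpa [minLoop, takeMin, Stmt.stores] using hk
  · exact List.not_mem_append hc hcounter
  refine wp_seq (wp_mono (c := c) ?_ (wp_frame (init i hi s₁ hs₁ hi₁)))
  rintro s₂ ⟨hbest, hs₂⟩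
  have hi₂ : s₂.var a.counter = i := by rw [hs₂.var _ hc, hi₁]
  refine wp_minLoop hv hL (hbest ▸ hg i hi) (hf i hi) (fun j hj s₃ hs₃ hj₃ => ?_)
    fun s₃ _ h₃ => by rw [h₃, hbest]
  refine h i hi j hj s₃ (hs₁.trans ?_) (by rw [hs₃.var _ hcounter, hi₂]) hj₃
  exact (hs₂.seq_left.trans hs₃.seq_right).seq_left.loop

/-- A sweep that started in the state `s` has come to the entry `(i, j)`: the earlier entries of the
array `k` have been replaced by those of `f`, and `bad` has been raised if one of them was not
`good`. -/
structure Swept (N : ℕ) (k : Arr) (f : ℕ → ℕ → ℤ) (good : ℕ → ℕ → Prop) (s : State) (i j : ℕ)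
    (s' : State) : Prop where
  arr : ∀ a, ∀ b < N, s'.arr k a b = if a < i ∨ a = i ∧ b < j then f a b else s.arr k a b
  bad : s'.var .bad = 0 ↔
    s.var .bad = 0 ∧ ∀ a, ∀ b < N, a < i ∨ a = i ∧ b < j → good a b

theorem Swept.congr {k : Arr} {f : ℕ → ℕ → ℤ} {good : ℕ → ℕ → Prop} {i j : ℕ}
    (h : Swept N k f good s i j s') (harr : s''.arr = s'.arr)
    (hbad : s''.var .bad = s'.var .bad) : Swept N k f good s i j s'' :=
  ⟨by rw [harr]; exact h.arr, by rw [hbad]; exact h.bad⟩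

theorem Swept.arr_self {k : Arr} {f : ℕ → ℕ → ℤ} {good : ℕ → ℕ → Prop} {i j : ℕ}
    (h : Swept N k f good s i j s') (hj : j < N) : s'.arr k i j = s.arr k i j := by
  rw [h.arr i j hj, if_neg (by omega)]

theorem Swept.newRow {k : Arr} {f : ℕ → ℕ → ℤ} {good : ℕ → ℕ → Prop} {i : ℕ}
    (h : Swept N k f good s i N s') : Swept N k f good s (i + 1) 0 s' := by
  have hiff : ∀ a, ∀ b < N, (a < i + 1 ∨ a = i + 1 ∧ b < 0) ↔ (a < i ∨ a = i ∧ b < N) := by omega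
  refine ⟨fun a b hb => ?_, ?_⟩
  · simp only [h.arr a b hb, hiff a b hb]
  · rw [h.bad]
    exact and_congr_right fun _ => forall₃_congr fun a b hb => by rw [hiff a b hb]

theorem Swept.step {k : Arr} {f : ℕ → ℕ → ℤ} {good : ℕ → ℕ → Prop} {i j : ℕ} (hj : j < N)
    (h : Swept N k f good s i j s')
    (harr : ∀ a b, s''.arr k a b = if a = i ∧ b = j then f i j else s'.arr k a b)
    (hbad : s''.var .bad = 0 ↔ s'.var .bad = 0 ∧ good i j) :
    Swept N k f good s i (j + 1) s'' := by
  refine ⟨fun a b hb => ?_, ?_⟩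
  · rw [harr, h.arr a b hb]
    grind
  · rw [hbad, h.bad]
    grind

/-- The part of a sweep that runs through one row. -/
def sweepRow (c : Stmt) : Stmt := .loop .col .cols (c ;; .sign ::= 0 - Var.sign)

/-- Run through all entries in row-major order, with `sign` alternating like a chessboard. -/
def sweep (c : Stmt) : Stmt :=
  .rowSign ::= 1 ;;
    .loop .row .rows (.sign ::= Var.rowSign ;; sweepRow c ;; .rowSign ::= 0 - Var.rowSign)

theorem Expr.safe_negate {n : ℕ} (hB : 1 ≤ B) (h : s.var v = (-1) ^ n) :
    (0 - (v : Expr)).Safe M N B s := by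
  refine ⟨B.zero_le, trivial, ?_⟩
  simpa [Op.eval, Expr.eval, h, Int.natAbs_pow] using hB

theorem wp_sweepRow {k : Arr} {f : ℕ → ℕ → ℤ} {good : ℕ → ℕ → Prop} {i : ℕ} {s₀ : State}
    (hB : 1 ≤ B) (hc : c.writes ⊆ [.best, .bad]) (hrow : s.var .row = i)
    (hsign : s.var .sign = (-1) ^ i) (hs : Swept N k f good s₀ i 0 s)
    (h : ∀ j < N, ∀ s', Frame (sweepRow c) s s' → s'.var .row = i → s'.var .col = j →
      s'.var .sign = (-1) ^ (i + j) → Swept N k f good s₀ i j s' → wp M N B c (fun s'' =>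
        (∀ a b, s''.arr k a b = if a = i ∧ b = j then f i j else s'.arr k a b) ∧
        (s''.var .bad = 0 ↔ s'.var .bad = 0 ∧ good i j)) s')
    (post : ∀ s', Frame (sweepRow c) s s' → Swept N k f good s₀ (i + 1) 0 s' → Q s') :
    wp M N B (sweepRow c) Q s := by
  have hw : ∀ v, v ≠ .best → v ≠ .bad → v ∉ c.writes := fun v h₁ h₂ hv => by
    simpa [h₁, h₂] using hc hv
  refine wp_loop (fun j s' => s'.var .sign = (-1) ^ (i + j) ∧ Swept N k f good s₀ i j s') ?_ ?_ ?_
    fun s' hf h' => post s' hf h'.2.newRow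
  · simp [Stmt.writes, hw]
  · exact ⟨by simp [hsign], hs.congr rfl (by simp)⟩
  · rintro j hj s₁ hs₁ hcol ⟨hsign₁, hswept⟩
    have hrow₁ : s₁.var .row = i := by rw [hs₁.var _ (by simp [Stmt.writes, hw]), hrow]
    refine wp_seq (wp_mono (c := c) ?_ (wp_frame (h j hj s₁ hs₁ hrow₁ hcol hsign₁ hswept)))
    rintro s₂ ⟨⟨harr, hbad⟩, hs₂⟩
    have hsign₂ : s₂.var .sign = (-1) ^ (i + j) := by
      rw [hs₂.var _ (hw _ (by simp) (by simp)), hsign₁]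
    refine ⟨Expr.safe_negate hB hsign₂, ?_, (hswept.step hj harr hbad).congr rfl (by simp)⟩
    simp only [State.set_var, Expr.eval_sub, Expr.eval, hsign₂]
    simp [← add_assoc, pow_succ]

theorem wp_sweep {k : Arr} {f : ℕ → ℕ → ℤ} {good : ℕ → ℕ → Prop} (hB : 1 ≤ B)
    (hc : c.writes ⊆ [.best, .bad])
    (h : ∀ i < M, ∀ j < N, ∀ s', Frame (sweep c) s s' → s'.var .row = i → s'.var .col = j →
      s'.var .sign = (-1) ^ (i + j) → Swept N k f good s i j s' → wp M N B c (fun s'' =>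
        (∀ a b, s''.arr k a b = if a = i ∧ b = j then f i j else s'.arr k a b) ∧
        (s''.var .bad = 0 ↔ s'.var .bad = 0 ∧ good i j)) s')
    (post : ∀ s', Frame (sweep c) s s' → HasTable M N s' k f →
      (s'.var .bad = 0 ↔ s.var .bad = 0 ∧ ∀ i < M, ∀ j < N, good i j) → Q s') :
    wp M N B (sweep c) Q s := by
  have hw : ∀ v, v ≠ .best → v ≠ .bad → v ∉ c.writes := fun v h₁ h₂ hv => by
    simpa [h₁, h₂] using hc hv
  have hstart : Frame (sweep c) s (s.set .rowSign 1) := Frame.seq_left (.assign _ 1)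
  refine wp_seq ⟨hB, wp_loop
    (fun i s' => s'.var .rowSign = (-1) ^ i ∧ Swept N k f good s i 0 s') ?_ ?_ ?_ ?_⟩
  · simp [Stmt.writes, sweepRow, hw]
  · exact ⟨by simp [Expr.eval], by simp, by simp⟩
  · rintro i hi s₁ hs₁ hrow ⟨hrowSign, hswept⟩
    refine wp_seq ⟨trivial, wp_seq (wp_sweepRow (s₀ := s) hB hc ?_ ?_ (hswept.congr rfl ?_) ?_ ?_)⟩
    · simpa using hrow
    · simpa [Expr.eval] using hrowSign
    · simp
    · intro j hj s₂ hs₂ hrow₂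
      exact h i hi j hj s₂ ((hstart.trans hs₁.seq_right).trans
        ((Frame.seq_left (.assign _ _)).trans hs₂.seq_left.seq_right).loop.seq_right) hrow₂
    · intro s₂ hs₂ hswept₂
      have hrowSign₂ : s₂.var .rowSign = (-1) ^ i := by
        rw [hs₂.var _ (by simp [Stmt.writes, sweepRow, hw])]; simpa using hrowSign
      refine ⟨Expr.safe_negate hB hrowSign₂, ?_, hswept₂.congr rfl (by simp)⟩
      simp only [State.set_var, Expr.eval_sub, Expr.eval, hrowSign₂]
      simp [pow_succ]
  · rintro s' hs' ⟨-, hswept⟩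
    refine post s' (hstart.trans hs'.seq_right) (fun i hi j hj => ?_) ?_
    · rw [hswept.arr i j hj, if_pos (.inl hi)]
    · rw [hswept.bad]
      exact and_congr_right fun _ => ⟨fun h i hi j hj => h i j hj (.inl hi),
        fun h i j hj hij => h i (by simpa [extent] using hij) j hj⟩

/-! ### The program -/

/-- The entry at the position given by the counters of rows and columns. -/
def cell (k : Arr) : Expr := .entry k Var.row Var.col

/-- Assignment to the entry at the position given by the counters of rows and columns. -/
def setCell (k : Arr) (e : Expr) : Stmt := .store k Var.row Var.col e

section Cell

variable {k : Arr} {i j : ℕ} (hi : i < M) (hj : j < N) (hrow : s.var .row = i)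
  (hcol : s.var .col = j)
include hi hj hrow hcol

theorem inBounds_cell : InBounds M N (s.var .row) (s.var .col) := by
  simp [InBounds, hrow, hcol, hi, hj]

theorem safe_cell : (cell k).Safe M N B s := ⟨trivial, trivial, inBounds_cell hi hj hrow hcol⟩

omit hi hj in
theorem eval_cell : (cell k).eval M N s = s.arr k i j := by simp [cell, Expr.eval, hrow, hcol]

theorem wp_setCell (he : e.Safe M N B s) (hQ : Q (s.setArr k i j (e.eval M N s))) :
    wp M N B (setCell k e) Q s := by
  refine ⟨⟨trivial, trivial, inBounds_cell hi hj hrow hcol⟩, he, ?_⟩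
  simpa only [Expr.eval, hrow, hcol, Int.toNat_natCast] using hQ

end Cell

/-- Store the least entries of the rows of `table` in `cost`. -/
def rowMins : Stmt :=
  tabulateMin .rows .cost (.best ::= .entry .table Var.row 0) .col .cols .zero 0 (cell .table)

/-- Shift the rows of `table` so that their least entries are zero. -/
def normalise : Stmt := rowMins ;; sweep (setCell .table (cell .table - Axis.get .rows .cost))

section Table

variable {W V : ℕ → ℕ → ℤ} {L : ℕ} (hM : 0 < M) (hN : 0 < N)
include hM hN

theorem wp_rowMins (hL : 2 * L ≤ B) (hW : HasTable M N s .table W)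
    (hbound : ∀ i < M, ∀ j < N, (W i j).natAbs ≤ L)
    (post : ∀ s', Frame rowMins s s' → HasVec M N s' .rows .cost (rowMin N W) → Q s') :
    wp M N B rowMins Q s := by
  refine wp_tabulateMin (p := fun _ _ => True) (f := W) (g := fun i => W i 0) hM hN (by decide)
    (by decide) (by decide) (by decide) hL (fun i hi => hbound i hi 0 hN) hbound ?_ ?_ post
  · rintro i (hi : i < M) s₁ hs₁ (hrow : s₁.var .row = i)
    refine ⟨⟨trivial, B.zero_le, by simp [InBounds, Expr.eval, hrow, hi, hN]⟩, ?_⟩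
    simpa [Expr.eval, hrow] using hW.frame hs₁ (by decide) i hi 0 hN
  · rintro i hi j hj s₁ hs₁ hrow hcol
    refine ⟨⟨B.zero_le, by simp [Test.Holds, Expr.eval]⟩, safe_cell hi hj hrow hcol, ?_⟩
    rw [eval_cell hrow hcol, hW.frame hs₁ (by decide) i hi j hj]

theorem wp_normalise (hL : 2 * L ≤ B) (hB : 1 ≤ B) (hW : HasTable M N s .table W)
    (hbound : ∀ i < M, ∀ j < N, (W i j).natAbs ≤ L)
    (post : ∀ s', Frame normalise s s' → HasTable M N s' .table (normalized N W) → Q s') :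
    wp M N B normalise Q s := by
  refine wp_seq (wp_rowMins hM hN hL hW hbound fun s₁ hs₁ hcost => ?_)
  have hW₁ : HasTable M N s₁ .table W := hW.frame hs₁ (by decide)
  refine wp_sweep (k := .table) (f := normalized N W) (good := fun _ _ => True) hB (by decide) ?_
    fun s₂ hs₂ htable _ => post s₂ (hs₁.seq_left.trans hs₂.seq_right) htable
  rintro i hi j hj s₂ hs₂ hrow hcol - hswept
  have hcell : (cell .table).eval M N s₂ = W i j := by
    rw [eval_cell hrow hcol, hswept.arr_self hj, hW₁ i hi j hj]
  have hget : (Axis.get .rows .cost).eval M N s₂ = rowMin N W i := by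
    rw [eval_get hrow, hcost.frame hs₂ (by decide) i hi]
  refine wp_setCell hi hj hrow hcol
    ⟨safe_cell hi hj hrow hcol, safe_get hM hN hi hrow, ?_⟩ ⟨fun a b => ?_, by simp⟩
  · exact (congrArg₂ (fun x y : ℤ => (x - y).natAbs) hcell hget).trans_le
      ((natAbs_normalized_le (hbound i hi) hj).trans hL)
  · simp [hcell, hget, normalized]

end Table

/-- Count the zeros of the row in `best`. -/
def countZeros : Stmt :=
  .best ::= 0 ;; .loop .col .cols (.ite .zero (cell .table) (.best ::= Var.best + 1) .skip)

/-- Store the costs of the rows of `table` in `cost`. -/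
def costs : Stmt := tabulateMin .rows .cost countZeros .col .cols .neg (1 - cell .table) 0

/-- Store the levels of the columns of `table` in `level`. -/
def levels : Stmt :=
  tabulateMin .cols .level (.best ::= .dim .cols + 1) .row .rows .zero (cell .table)
    (Axis.get .rows .cost)

/-- Store the reaches of the rows of `table` in `reach`. -/
def reaches : Stmt :=
  tabulateMin .rows .reach (.best ::= .dim .cols + 1) .col .cols .neg (0 - cell .table)
    (Axis.get .cols .level)

section Levels

variable {V : ℕ → ℕ → ℤ} (hM : 0 < M) (hN : 0 < N) (hB : 2 * (N + 1) ≤ B)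
  (hV : HasTable M N s .table V)

include hB in
theorem wp_initLevel : wp M N B (.best ::= .dim .cols + 1) (fun s' => s'.var .best = N + 1) s := by
  refine ⟨⟨trivial, (by omega : 1 ≤ B), ?_⟩, by simp [Op.eval, Expr.eval, extent]⟩
  simp only [Op.eval, Expr.eval, extent]
  omega

include hB hV in
theorem wp_countZeros {i : ℕ} (hi : i < M) (hrow : s.var .row = i) :
    wp M N B countZeros (fun s' => s'.var .best = zeros N (V i)) s := by
  refine wp_seq ⟨B.zero_le, ?_⟩
  refine wp_loop (fun j s' => s'.var .best = zeros j (V i)) (by decide) ?_ ?_ fun _ _ h => h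
  · simp [Expr.eval, zeros]
  · intro j hj s₁ hs₁ hcol hbest
    have hrow₁ : s₁.var .row = i := by rw [hs₁.var _ (by decide)]; simpa using hrow
    have hcell : (cell .table).eval M N s₁ = V i j := by
      rw [eval_cell hrow₁ hcol, hs₁.arr _ (by decide), State.set_arr, hV i hi j hj]
    have hzeros := zeros_le j (V i)
    have hj' : j < N := hj
    refine ⟨safe_cell hi hj hrow₁ hcol, fun hzero => ⟨⟨trivial, ?_, ?_⟩, ?_⟩, fun hzero => ?_⟩
    · simp only [Expr.Safe]; omega
    · simp only [Op.eval, Expr.eval, hbest]; omega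
    · rw [Test.Holds, hcell] at hzero
      simp [zeros_succ, hzero, hbest, Op.eval, Expr.eval]
    · rw [Test.Holds, hcell] at hzero
      simp [wp, zeros_succ, hzero, hbest]

include hM hN hB hV

theorem wp_costs (hbound : ∀ i < M, ∀ j < N, (V i j).natAbs < B)
    (post : ∀ s', Frame costs s s' → HasVec M N s' .rows .cost (cost N V) → Q s') :
    wp M N B costs Q s := by
  refine wp_tabulateMin (p := fun i j => 2 ≤ V i j) (f := fun _ _ => 0)
    (g := fun i => zeros N (V i)) (L := N + 1) hM hN (by decide) (by decide) (by decide)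
    (by decide) hB (fun i _ => ?_) (by simp) (fun i hi s₁ hs₁ hrow => ?_) ?_ post
  · have := zeros_le N (V i)
    omega
  · exact wp_countZeros hB (hV.frame hs₁ (by decide)) hi hrow
  · intro i hi j hj s₁ hs₁ hrow hcol
    have hcell : (cell .table).eval M N s₁ = V i j := by
      rw [eval_cell hrow hcol, hV.frame hs₁ (by decide) i hi j hj]
    have := hbound i hi j hj
    refine ⟨⟨⟨(by omega : 1 ≤ B), safe_cell hi hj hrow hcol, ?_⟩, ?_⟩, B.zero_le, rfl⟩
    · simp only [Op.eval, hcell, Expr.eval_ofNat]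
      omega
    · simp only [Test.Holds, Expr.eval_sub, Expr.eval_ofNat, hcell]
      omega

theorem wp_levels (hcost : HasVec M N s .rows .cost (cost N V))
    (post : ∀ s', Frame levels s s' → HasVec M N s' .cols .level (level M N V) → Q s') :
    wp M N B levels Q s := by
  refine wp_tabulateMin (p := fun j i => V i j = 0) (f := fun _ => cost N V)
    (g := fun _ => N + 1) (L := N + 1) hM hN (by decide) (by decide) (by decide) (by decide) hB
    (fun _ _ => by omega) (fun _ _ i _ => ?_) (fun _ _ _ _ _ => wp_initLevel hB) ?_ post
  · exact (natAbs_cost_le N V i).trans N.le_succ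
  · rintro j hj i hi s₁ hs₁ hcol hrow
    refine ⟨⟨safe_cell hi hj hrow hcol, ?_⟩, safe_get hM hN hi hrow, ?_⟩
    · rw [Test.Holds, eval_cell hrow hcol, hV.frame hs₁ (by decide) i hi j hj]
    · rw [eval_get hrow, hcost.frame hs₁ (by decide) i hi]

theorem wp_reaches (hbound : ∀ i < M, ∀ j < N, (V i j).natAbs < B)
    (hlevel : HasVec M N s .cols .level (level M N V))
    (post : ∀ s', Frame reaches s s' → HasVec M N s' .rows .reach (reach M N V) → Q s') :
    wp M N B reaches Q s := by
  refine wp_tabulateMin (p := fun i j => 0 < V i j) (f := fun _ => level M N V)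
    (g := fun _ => N + 1) (L := N + 1) hM hN (by decide) (by decide) (by decide) (by decide) hB
    (fun _ _ => by omega) (fun _ _ j _ => natAbs_level_le M N V j)
    (fun _ _ _ _ _ => wp_initLevel hB) ?_ post
  rintro i hi j hj s₁ hs₁ hrow hcol
  have hcell : (cell .table).eval M N s₁ = V i j := by
    rw [eval_cell hrow hcol, hV.frame hs₁ (by decide) i hi j hj]
  have := hbound i hi j hj
  refine ⟨⟨⟨B.zero_le, safe_cell hi hj hrow hcol, ?_⟩, ?_⟩, safe_get hM hN hj hcol, ?_⟩
  · simp only [Op.eval, hcell, Expr.eval_ofNat]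
    omega
  · simp only [Test.Holds, Expr.eval_sub, Expr.eval_ofNat, hcell]
    omega
  · rw [eval_get hcol, hlevel.frame hs₁ (by decide) j hj]

end Levels

/-- Raise the threshold to the cost of the row, if the row is reached. -/
def raise : Stmt :=
  .ite .neg (Var.cutoff - Axis.get .rows .reach) .skip
    (.ite .neg (Var.cutoff - Axis.get .rows .cost) (.cutoff ::= Axis.get .rows .cost) .skip)

/-- Raise the threshold for every row. -/
def raiseRows : Stmt := .loop .row .rows raise

/-- Compute a closed threshold in `cutoff`. Every round raises the threshold unless it is closed,
and thresholds beyond the number of columns are closed. -/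
def threshold : Stmt := .cutoff ::= 0 ;; .loop .round .cols raiseRows

section Threshold

variable {V : ℕ → ℕ → ℤ} {q : ℤ} (hM : 0 < M) (hN : 0 < N) (hB : 2 * (N + 1) ≤ B)
  (hcost : HasVec M N s .rows .cost (cost N V)) (hreach : HasVec M N s .rows .reach (reach M N V))
include hM hN hB hcost hreach

theorem wp_raise {i : ℕ} (hq₀ : 0 ≤ q) (hq : q ≤ N) (hcutoff : s.var .cutoff = q) (hi : i < M)
    (hrow : s.var .row = i) : wp M N B raise (fun s' => s'.var .cutoff = raised M N V q i) s := by
  have hsafe (k : Arr) : (Axis.get .rows k).Safe M N B s := safe_get hM hN hi hrow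
  have hevalcost : (Axis.get .rows .cost).eval M N s = cost N V i := by
    rw [eval_get hrow, hcost i hi]
  have hevalreach : (Axis.get .rows .reach).eval M N s = reach M N V i := by
    rw [eval_get hrow, hreach i hi]
  have hcost_le := natAbs_cost_le N V i
  have hreach_le := natAbs_reach_le M N V i
  refine ⟨⟨trivial, hsafe _, ?_⟩, fun hneg => ?_, fun hneg => ⟨⟨trivial, hsafe _, ?_⟩,
    fun hneg' => ⟨hsafe _, ?_⟩, fun hneg' => ?_⟩⟩ <;>
    simp only [Op.eval, Test.Holds, Expr.eval_sub, Expr.eval, hevalcost, hevalreach, hcutoff,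
      State.set_var, if_true, wp, raised] at * <;> grind

theorem wp_raiseRows (hV : ∀ i < M, ∀ j < N, 0 ≤ V i j) (hq₀ : 0 ≤ q) (hq : q ≤ N)
    (hcutoff : s.var .cutoff = q) (hforced : Forced M N V q)
    (post : ∀ s', Frame raiseRows s s' → q ≤ s'.var .cutoff → s'.var .cutoff ≤ N →
      Forced M N V (s'.var .cutoff) → (s'.var .cutoff = q ↔ Closed M N V q) → Q s') :
    wp M N B raiseRows Q s := by
  refine wp_loop (fun i s' => q ≤ s'.var .cutoff ∧ s'.var .cutoff ≤ N ∧
      Forced M N V (s'.var .cutoff) ∧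
      (s'.var .cutoff = q ↔ ∀ i' < i, reach M N V i' ≤ q → cost N V i' ≤ q))
    (by decide) ?_ ?_ fun s' hs' ⟨h₁, h₂, h₃, h₄⟩ => post s' hs' h₁ h₂ h₃ h₄
  · simp [hcutoff, hq, hforced]
  · rintro i (hi : i < M) s₁ hs₁ hrow ⟨hle, hle', hforced₁, hiff⟩
    refine wp_mono (c := raise) (fun s₂ hs₂ => ?_) (wp_raise hM hN hB (hcost.frame hs₁ (by decide))
      (hreach.frame hs₁ (by decide)) (hq₀.trans hle) hle' rfl hi hrow)
    simp only [State.set_var, reduceCtorEq, if_false, hs₂]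
    refine ⟨hle.trans le_raised, raised_le hle', hforced₁.raised hV hle' hi, ?_⟩
    simp only [Nat.forall_lt_succ_right, ← hiff]
    refine ⟨fun h => ?_, fun ⟨h, hi⟩ => ?_⟩
    · have heq : s₁.var .cutoff = q := le_antisymm (le_raised.trans_eq h) hle
      rw [heq, raised_eq_self] at h
      exact ⟨heq, h⟩
    · rw [h, raised_eq_self.2 hi]

theorem wp_threshold (hV : ∀ i < M, ∀ j < N, 0 ≤ V i j)
    (post : ∀ s', Frame threshold s s' → 0 ≤ s'.var .cutoff → s'.var .cutoff ≤ N →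
      Forced M N V (s'.var .cutoff) → Closed M N V (s'.var .cutoff) → Q s') :
    wp M N B threshold Q s := by
  have hstart : Frame threshold s (s.set .cutoff 0) := Frame.seq_left (.assign _ 0)
  refine wp_seq ⟨B.zero_le, wp_loop (fun k s' => (0 ≤ s'.var .cutoff ∧ s'.var .cutoff ≤ N ∧
      Forced M N V (s'.var .cutoff)) ∧ (Closed M N V (s'.var .cutoff) ∨ k ≤ s'.var .cutoff))
    (by decide) ?_ ?_ fun s' hs' ⟨⟨h₁, h₂, h₃⟩, h₄⟩ =>
      post s' (hstart.trans hs'.seq_right) h₁ h₂ h₃ (h₄.elim id closed_of_le)⟩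
  · simp [Expr.eval, forced_zero]
  · rintro k - s₁ hs₁ - ⟨⟨h₀, hle, hforced⟩, hclosed⟩
    have hs : Frame threshold s s₁ := hstart.trans hs₁.seq_right
    refine wp_raiseRows hM hN hB (hcost.frame hs (by decide)) (hreach.frame hs (by decide)) hV h₀
      hle rfl hforced fun s₂ _ h₁ h₂ h₃ h₄ => ?_
    simp only [State.set_var, reduceCtorEq, if_false]
    refine ⟨⟨h₀.trans h₁, h₂, h₃⟩, ?_⟩
    rcases h₁.eq_or_lt with heq | hlt
    · rw [← heq]
      exact .inl (h₄.1 heq.symm)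
    · rcases hclosed with hclosed | hclosed
      · exact absurd (h₄.2 hclosed) hlt.ne'
      · push_cast
        exact .inr (by omega)

end Threshold

/-- Add 1 to the columns of `table` up to the level `cutoff`. -/
def addOffsets : Stmt :=
  sweep (.ite .neg (Var.cutoff - Axis.get .cols .level) .skip (setCell .table (cell .table + 1)))

theorem wp_addOffsets {V : ℕ → ℕ → ℤ} {q : ℤ} (hM : 0 < M) (hN : 0 < N) (hB : 2 * (N + 1) ≤ B)
    (hV : HasTable M N s .table V) (hbound : ∀ i < M, ∀ j < N, (V i j).natAbs < B)
    (hlevel : HasVec M N s .cols .level (level M N V)) (hcutoff : s.var .cutoff = q)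
    (hq₀ : 0 ≤ q) (hq : q ≤ N)
    (post : ∀ s', Frame addOffsets s s' →
      HasTable M N s' .table (fun i j => V i j + offset M N V q j) → Q s') :
    wp M N B addOffsets Q s := by
  refine wp_sweep (k := .table) (f := fun i j => V i j + offset M N V q j)
    (good := fun _ _ => True) (by omega) (by decide) ?_ fun s₁ hs₁ htable _ => post s₁ hs₁ htable
  rintro i hi j hj s₁ hs₁ hrow hcol - hswept
  have hcell : (cell .table).eval M N s₁ = V i j := by
    rw [eval_cell hrow hcol, hswept.arr_self hj, hV i hi j hj]
  have hget : (Axis.get .cols .level).eval M N s₁ = level M N V j := by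
    rw [eval_get hcol, hlevel.frame hs₁ (by decide) j hj]
  have hcutoff₁ : s₁.var .cutoff = q := by rw [hs₁.var _ (by decide), hcutoff]
  have hlevel_le := natAbs_level_le M N V j
  have hbound' := hbound i hi j hj
  refine ⟨⟨trivial, safe_get hM hN hj hcol, ?_⟩, fun hneg => ⟨fun a b => ?_, by simp⟩,
    fun hneg => wp_setCell hi hj hrow hcol ⟨safe_cell hi hj hrow hcol, ?_, ?_⟩
      ⟨fun a b => ?_, by simp⟩⟩
  · simp only [Op.eval, Expr.eval, hget, hcutoff₁]
    omega
  · have hlt : ¬ level M N V j ≤ q := by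
      simp only [Test.Holds, Expr.eval_sub, Expr.eval, hget, hcutoff₁] at hneg
      omega
    split_ifs with hab
    · rw [hab.1, hab.2, hswept.arr_self hj, hV i hi j hj, offset, if_neg hlt, add_zero]
    · rfl
  · simp only [Expr.Safe]
    omega
  · simp only [Op.eval, Expr.eval, hcell]
    omega
  · have hle : level M N V j ≤ q := by
      simp only [Test.Holds, Expr.eval_sub, Expr.eval, hget, hcutoff₁] at hneg
      omega
    simp [hcell, offset, hle]

/-- Replace `best` by 2 and raise `bad` if `best` is not in range. -/
def clamp : Stmt :=
  .ite .neg Var.best (.best ::= 2 ;; .bad ::= 1) .skip ;;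
    .ite .neg (4 - Var.best) (.best ::= 2 ;; .bad ::= 1) .skip

open Classical in
theorem wp_clamp {z : ℤ} (hz : s.var .best = z) (hB : z.natAbs + 4 ≤ B)
    (post : ∀ s', Frame clamp s s' → s'.var .best = (if InRange z then z else 2) →
      (s'.var .bad = 0 ↔ s.var .bad = 0 ∧ InRange z) → Q s') :
    wp M N B clamp Q s := by
  refine wp_mono (fun s' (h : (_ ∧ _) ∧ _) => post s' h.2 h.1.1 h.1.2) (wp_frame ?_)
  have h₁ : 1 ≤ B := by omega
  have h₂ : 2 ≤ B := by omega
  have h₄ : 4 ≤ B := by omega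
  by_cases hneg : z < 0
  · have hout : ¬InRange z := fun h => hneg.not_ge h.1
    simp [clamp, wp, hout, Expr.Safe, Expr.eval, Test.Holds, hz, hneg, h₁, h₂, h₄]
  · have hsub : (4 - z).natAbs ≤ B := by omega
    by_cases hlarge : 4 - z < 0
    · have hout : ¬InRange z := fun h => hlarge.not_ge (sub_nonneg.2 h.2)
      simp [clamp, wp, hout, Expr.Safe, Expr.eval, Test.Holds, hz, hneg, h₁, h₂, h₄, hlarge, hsub]
    · have hin : InRange z := ⟨not_lt.1 hneg, sub_nonneg.1 (not_lt.1 hlarge)⟩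
      simp [clamp, wp, hin, Expr.Safe, Expr.eval, Test.Holds, hz, hneg, h₄, hlarge, hsub]

/-- The array `io` holds the `m × n` matrix `S` in row-major order. -/
def HasInput (m n : ℕ) (s : State) (S : ℕ → ℕ → ℤ) : Prop :=
  ∀ i < m, ∀ j < n, s.arr .io ((i * n + j) / (n + 1)) ((i * n + j) % (n + 1)) = S i j

/-- The previous row or column index. -/
def before (v : Var) : Expr := v - 1

theorem eval_before {k : ℕ} (h : s.var v = (k + 1 : ℕ)) : (before v).eval M N s = k := by
  simp [before, Expr.eval, h]

theorem safe_before {k : ℕ} (h : s.var v = (k + 1 : ℕ)) (hB : 1 ≤ B) (hk : k ≤ B) :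
    (before v).Safe M N B s := by
  refine ⟨trivial, hB, ?_⟩
  simpa [Op.eval, Expr.eval, h] using hk

/-- Read the window sum below and to the right of the preceding entry, with values out of range
replaced by 2. -/
def readWindow : Stmt :=
  .best ::= .flat (before .row * (.dim .cols - 1) + before .col) ;; clamp

/-- Compute an entry of the table of double sums from the preceding ones. -/
def extendTable : Stmt :=
  setCell .table ((Var.best - 2) * Var.sign + .entry .table (before .row) Var.col +
    .entry .table Var.row (before .col) - .entry .table (before .row) (before .col))

/-- Store the double sums of the input in `table`. -/
def build : Stmt :=
  sweep (.ite .zero (Var.row * Var.col) (setCell .table 0) (readWindow ;; extendTable))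

section Build

variable {m n i j : ℕ} {S : ℕ → ℕ → ℤ}

theorem natAbs_doubleSum_le_of_lt (S : ℕ → ℕ → ℤ) (hi : i < m + 1) (hj : j < n + 1) :
    (doubleSum S i j).natAbs ≤ 2 * ((m + 1) * (n + 1)) :=
  (natAbs_doubleSum_le S i j).trans <| Nat.mul_le_mul_left 2 <| Nat.mul_le_mul hi.le hj.le

variable (hB : 8 * ((m + 1) * (n + 1)) ≤ B) (hi : i < m) (hj : j < n)
  (hrow : s.var .row = (i + 1 : ℕ)) (hcol : s.var .col = (j + 1 : ℕ))
include hB hi hj hrow hcol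

open Classical in
theorem wp_readWindow (hinput : HasInput m n s S) (hS : (S i j).natAbs + 4 ≤ B)
    (post : ∀ s', Frame readWindow s s' →
      s'.var .best = (if InRange (S i j) then S i j else 2) →
      (s'.var .bad = 0 ↔ s.var .bad = 0 ∧ InRange (S i j)) → Q s') :
    wp (m + 1) (n + 1) B readWindow Q s := by
  have hm : m + 1 ≤ (m + 1) * (n + 1) := Nat.le_mul_of_pos_right _ n.succ_pos
  have hn : n + 1 ≤ (m + 1) * (n + 1) := Nat.le_mul_of_pos_left _ m.succ_pos
  have hindex : i * n + j < (m + 1) * (n + 1) :=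
    (Nat.add_le_add_right (Nat.mul_le_mul_left i n.le_succ) j).trans_lt
      (mul_add_lt (hi.trans m.lt_succ_self) (hj.trans n.lt_succ_self))
  have hwidth : (Expr.dim .cols - 1).eval (m + 1) (n + 1) s = n := by
    simp [Expr.eval, extent]
  have hflat : (before .row * (.dim .cols - 1) + before .col).eval (m + 1) (n + 1) s =
      (i * n + j : ℕ) := by
    rw [Expr.eval_add, Expr.eval_mul, eval_before hrow, eval_before hcol, hwidth]
    norm_cast
  have hsafe : (before .row * (.dim .cols - 1) + before .col).Safe (m + 1) (n + 1) B s := by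
    refine ⟨⟨safe_before hrow (by omega) (by omega), ⟨trivial, ?_, ?_⟩, ?_⟩,
      safe_before hcol (by omega) (by omega), ?_⟩
    · simp only [Expr.Safe]; omega
    · exact (congrArg Int.natAbs hwidth).trans_le (by omega)
    · simp only [Op.eval, eval_before hrow, hwidth]
      norm_cast
      omega
    · exact (congrArg Int.natAbs hflat).trans_le (by omega)
  have hread : (Expr.flat (before .row * (.dim .cols - 1) + before .col)).eval (m + 1) (n + 1) s =
      S i j := by
    rw [Expr.eval, hflat]
    exact hinput i hi j hj
  refine wp_seq ⟨⟨hsafe, by omega, ?_⟩, wp_clamp ?_ hS fun s₁ hs₁ hbest hbad => ?_⟩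
  · rw [hflat]
    exact_mod_cast hindex
  · simpa using hread
  · refine post s₁ ((Frame.seq_left (.assign _ _)).trans hs₁.seq_right) hbest ?_
    simpa using hbad

theorem wp_extendTable (hsign : s.var .sign = (-1) ^ (i + j))
    (hbest : (s.var .best - 2).natAbs ≤ 2)
    (htable : ∀ a, ∀ b < n + 1, a < i + 1 ∨ a = i + 1 ∧ b < j + 1 →
      s.arr .table a b = doubleSum S a b)
    (hQ : Q (s.setArr .table (i + 1) (j + 1) ((s.var .best - 2) * (-1) ^ (i + j) +
      doubleSum S i (j + 1) + doubleSum S (i + 1) j - doubleSum S i j))) :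
    wp (m + 1) (n + 1) B extendTable Q s := by
  have hm : m + 1 ≤ (m + 1) * (n + 1) := Nat.le_mul_of_pos_right _ n.succ_pos
  have hn : n + 1 ≤ (m + 1) * (n + 1) := Nat.le_mul_of_pos_left _ m.succ_pos
  have hrow' := safe_before (M := m + 1) (N := n + 1) hrow (by omega) (by omega : i ≤ B)
  have hcol' := safe_before (M := m + 1) (N := n + 1) hcol (by omega) (by omega : j ≤ B)
  have hsigned : ((s.var .best - 2) * (-1) ^ (i + j)).natAbs ≤ 2 := by
    simpa [Int.natAbs_mul, Int.natAbs_pow] using hbest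
  have h₁ := natAbs_doubleSum_le_of_lt S (by omega : i < m + 1) (by omega : j + 1 < n + 1)
  have h₂ := natAbs_doubleSum_le_of_lt S (by omega : i + 1 < m + 1) (by omega : j < n + 1)
  have h₃ := natAbs_doubleSum_le_of_lt S (by omega : i < m + 1) (by omega : j < n + 1)
  have hindex (k : ℕ) : ((k : ℤ) + 1).toNat = k + 1 := by omega
  have hN := htable i (j + 1) (by omega) (.inl (by omega))
  have hW := htable (i + 1) j (by omega) (.inr ⟨rfl, by omega⟩)
  have hNW := htable i j (by omega) (.inl (by omega))
  refine wp_setCell (by omega) (by omega) hrow hcol ?_ ?_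
  · simp only [InBounds, Expr.Safe, Expr.safe_sub, Expr.eval, Expr.eval_sub, Op.eval, hrow', hcol',
      eval_before hrow, eval_before hcol, hrow, hcol, hsign, hindex, hN, hW, hNW, Int.toNat_natCast,
      Nat.cast_add, Nat.cast_one, Nat.cast_ofNat, Int.reduceAbs, true_and]
    omega
  · simpa [Expr.eval, Op.eval, eval_before hrow, eval_before hcol, hrow, hcol, hsign, hindex, hN,
      hW, hNW] using hQ

theorem wp_readWindow_extendTable (hsign : s.var .sign = (-1) ^ (i + 1 + (j + 1)))
    (hinput : HasInput m n s S) (hS : (S i j).natAbs + 4 ≤ B)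
    (htable : ∀ a, ∀ b < n + 1, a < i + 1 ∨ a = i + 1 ∧ b < j + 1 →
      s.arr .table a b = doubleSum S a b) :
    wp (m + 1) (n + 1) B (readWindow ;; extendTable) (fun s' =>
      (∀ a b, s'.arr .table a b =
        if a = i + 1 ∧ b = j + 1 then doubleSum S (i + 1) (j + 1) else s.arr .table a b) ∧
      (s'.var .bad = 0 ↔ s.var .bad = 0 ∧ InRange (S i j))) s := by
  classical
  refine wp_seq (wp_readWindow hB hi hj hrow hcol hinput hS fun s₁ hs₁ hbest hbad => ?_)
  have hsign₁ : s₁.var .sign = (-1) ^ (i + j) := by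
    rw [hs₁.var _ (by decide), hsign]
    ring
  refine wp_extendTable (S := S) hB hi hj (by rw [hs₁.var _ (by decide), hrow])
    (by rw [hs₁.var _ (by decide), hcol]) hsign₁ ?_ (fun a b hb hab => ?_) ⟨fun a b => ?_, hbad⟩
  · rw [hbest, InRange]
    split_ifs <;> omega
  · rw [hs₁.arr _ (by decide), htable a b hb hab]
  · simp [hs₁.arr .table (by decide), doubleSum_succ, mixedDiff, hbest]

omit hi hj hrow hcol

theorem wp_build (hS : ∀ i < m, ∀ j < n, (S i j).natAbs + 4 ≤ B) (hinput : HasInput m n s S)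
    (post : ∀ s', Frame build s s' → HasTable (m + 1) (n + 1) s' .table (doubleSum S) →
      (s'.var .bad = 0 ↔ s.var .bad = 0 ∧ ∀ i < m, ∀ j < n, InRange (S i j)) → Q s') :
    wp (m + 1) (n + 1) B build Q s := by
  classical
  have hpos : 0 < (m + 1) * (n + 1) := Nat.mul_pos m.succ_pos n.succ_pos
  refine wp_sweep (k := .table) (f := doubleSum S)
    (good := fun i j => ∀ i' j', i = i' + 1 → j = j' + 1 → InRange (S i' j')) (by omega)
    (by decide) ?_ fun s₁ hs₁ htable hbad => post s₁ hs₁ htable ?_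
  · rintro i hi j hj s₁ hs₁ hrow hcol hsign hswept
    refine ⟨⟨trivial, trivial, ?_⟩, fun hzero => ?_, fun hzero => ?_⟩
    · simp only [Op.eval, Expr.eval, hrow, hcol]
      norm_cast
      have := Nat.mul_le_mul hi.le hj.le
      omega
    · have hij : i = 0 ∨ j = 0 := by simpa [Test.Holds, hrow, hcol, Expr.eval, Op.eval] using hzero
      have hsum : doubleSum S i j = 0 := by rcases hij with rfl | rfl <;> simp [doubleSum]
      refine wp_setCell hi hj hrow hcol B.zero_le ⟨fun a b => ?_, ?_⟩
      · simp [hsum]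
      · simp only [Expr.eval_ofNat, State.setArr_var, iff_self_and]
        omega
    · have hij : i ≠ 0 ∧ j ≠ 0 := by
        simpa [Test.Holds, hrow, hcol, Expr.eval, Op.eval] using hzero
      obtain ⟨i, rfl⟩ := Nat.exists_eq_succ_of_ne_zero hij.1
      obtain ⟨j, rfl⟩ := Nat.exists_eq_succ_of_ne_zero hij.2
      refine wp_mono (c := readWindow ;; extendTable) (fun s₂ h₂ => ⟨h₂.1, ?_⟩)
        (wp_readWindow_extendTable hB (by omega) (by omega) hrow hcol hsign ?_
          (hS i (by omega) j (by omega)) fun a b hb hab => ?_)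
      · simpa using h₂.2
      · exact fun a ha b hb => by rw [hs₁.arr _ (by decide), hinput a ha b hb]
      · rw [hswept.arr a b hb, if_pos hab]
  · rw [hbad]
    exact and_congr_right fun _ =>
      ⟨fun h i hi j hj => h (i + 1) (by omega) (j + 1) (by omega) i j rfl rfl,
        fun h i hi j hj i' j' hi' hj' => h i' (by omega) j' (by omega)⟩

end Build

/-- Copy `table` to `io`, with every other entry `z` replaced by `1 - z`, and raise `bad` if an
entry of `table` exceeds 1. -/
def emit : Stmt :=
  sweep (.ite .neg (1 - cell .table) (.bad ::= 1) .skip ;;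
    .ite .neg Var.sign (setCell .io (1 - cell .table)) (setCell .io (cell .table)))

theorem wp_emitCell {z : ℤ} {i j : ℕ} (hi : i < M) (hj : j < N) (hrow : s.var .row = i)
    (hcol : s.var .col = j) (hsign : s.var .sign = (-1) ^ (i + j)) (hB : 1 ≤ B)
    (hsub : (1 - z).natAbs ≤ B) (hz : s.arr .table i j = z)
    (hQ : Q (s.setArr .io i j (reflect (i + j) z))) :
    wp M N B (.ite .neg Var.sign (setCell .io (1 - cell .table)) (setCell .io (cell .table))) Q
      s := by
  have hsafe := safe_cell (k := .table) (B := B) hi hj hrow hcol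
  have hcell : (cell .table).eval M N s = z := by rw [eval_cell hrow hcol, hz]
  have hneg : Test.neg.Holds (Expr.eval M N s Var.sign) ↔ ¬ Even (i + j) := by
    rcases Nat.even_or_odd (i + j) with h | h
    · simp [Test.Holds, Expr.eval, hsign, h]
    · simp [Test.Holds, Expr.eval, hsign, h.neg_one_pow, Nat.not_even_iff_odd.2 h]
  refine ⟨trivial, fun hodd => wp_setCell hi hj hrow hcol ⟨hB, hsafe, ?_⟩ ?_,
    fun heven => wp_setCell hi hj hrow hcol hsafe ?_⟩
  · exact (congrArg (fun z => (1 - z).natAbs) hcell).trans_le hsub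
  · simpa [reflect, hneg.1 hodd, hcell] using hQ
  · simpa [reflect, not_not.1 (hneg.not.1 heven), hcell] using hQ

theorem wp_emit {Z : ℕ → ℕ → ℤ} (hB : 1 ≤ B) (hZ : HasTable M N s .table Z)
    (hbound : ∀ i < M, ∀ j < N, (Z i j).natAbs < B)
    (post : ∀ s', Frame emit s s' →
      HasTable M N s' .io (fun i j => reflect (i + j) (Z i j)) →
      (s'.var .bad = 0 ↔ s.var .bad = 0 ∧ ∀ i < M, ∀ j < N, Z i j ≤ 1) → Q s') :
    wp M N B emit Q s := by
  refine wp_sweep (k := .io) (f := fun i j => reflect (i + j) (Z i j))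
    (good := fun i j => Z i j ≤ 1) hB (by decide) ?_ post
  rintro i hi j hj s₁ hs₁ hrow hcol hsign -
  have hz : s₁.arr .table i j = Z i j := by rw [hs₁.arr _ (by decide), hZ i hi j hj]
  have hcell : (cell .table).eval M N s₁ = Z i j := by rw [eval_cell hrow hcol, hz]
  have hsub : (1 - Z i j).natAbs ≤ B := by
    have := hbound i hi j hj
    omega
  have hneg : Test.neg.Holds ((1 - cell .table).eval M N s₁) ↔ ¬ Z i j ≤ 1 := by
    simp [Test.Holds, hcell, Expr.eval]
  refine wp_seq ⟨⟨hB, safe_cell hi hj hrow hcol, ?_⟩, fun hbad => ⟨hB, ?_⟩, fun hbad => ?_⟩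
  · exact (congrArg (fun z => (1 - z).natAbs) hcell).trans_le hsub
  · refine wp_emitCell hi hj ?_ ?_ ?_ hB hsub hz ⟨fun a b => by simp, ?_⟩
    · simpa using hrow
    · simpa using hcol
    · simpa using hsign
    · simp [Expr.eval, hneg.1 hbad]
  · refine wp_emitCell hi hj hrow hcol hsign hB hsub hz ⟨fun a b => by simp, ?_⟩
    simp [not_not.1 (hneg.not.1 hbad)]

/-- Replace the double sums by the leveled table. -/
def solve : Stmt :=
  normalise ;; costs ;; levels ;; reaches ;; threshold ;; addOffsets ;; normalise

section Reconstruct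

variable {m n : ℕ} {S : ℕ → ℕ → ℤ}

theorem natAbs_normalized_doubleSum_le {i j : ℕ} (S : ℕ → ℕ → ℤ) (hi : i < m + 1)
    (hj : j < n + 1) :
    (normalized (n + 1) (doubleSum S) i j).natAbs ≤ 4 * ((m + 1) * (n + 1)) :=
  (natAbs_normalized_le (fun _ hb => natAbs_doubleSum_le_of_lt S hi hb) hj).trans (by omega)

theorem natAbs_normalized_add_offset_le {i j : ℕ} (S : ℕ → ℕ → ℤ) (q : ℤ) (hi : i < m + 1)
    (hj : j < n + 1) :
    (normalized (n + 1) (doubleSum S) i j +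
      offset (m + 1) (n + 1) (normalized (n + 1) (doubleSum S)) q j).natAbs ≤
        5 * ((m + 1) * (n + 1)) := by
  have hpos : 0 < (m + 1) * (n + 1) := Nat.mul_pos m.succ_pos n.succ_pos
  have h₁ := natAbs_normalized_doubleSum_le S hi hj
  have h₂ := offset_eq_zero_or_one (m + 1) (n + 1) (normalized (n + 1) (doubleSum S)) q j
  omega

theorem natAbs_leveled_le {i j : ℕ} (S : ℕ → ℕ → ℤ) (q : ℤ) (hi : i < m + 1) (hj : j < n + 1) :
    (leveled m n S q i j).natAbs ≤ 10 * ((m + 1) * (n + 1)) :=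
  (natAbs_normalized_le (fun _ hb => natAbs_normalized_add_offset_le S q hi hb) hj).trans (by omega)

variable (hB : 12 * ((m + 1) * (n + 1)) ≤ B)
include hB

theorem wp_solve (hW : HasTable (m + 1) (n + 1) s .table (doubleSum S))
    (post : ∀ s' q, Frame solve s s' → 0 ≤ q →
      Forced (m + 1) (n + 1) (normalized (n + 1) (doubleSum S)) q →
      Closed (m + 1) (n + 1) (normalized (n + 1) (doubleSum S)) q →
      HasTable (m + 1) (n + 1) s' .table (leveled m n S q) → Q s') :
    wp (m + 1) (n + 1) B solve Q s := by
  have hM := m.succ_pos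
  have hN := n.succ_pos
  have hpos : 0 < (m + 1) * (n + 1) := Nat.mul_pos hM hN
  have hn : n + 1 ≤ (m + 1) * (n + 1) := Nat.le_mul_of_pos_left _ hM
  have hN₂ : 2 * (n + 1 + 1) ≤ B := by omega
  have hV : ∀ i < m + 1, ∀ j < n + 1, (normalized (n + 1) (doubleSum S) i j).natAbs < B :=
    fun i hi j hj => (natAbs_normalized_doubleSum_le S hi hj).trans_lt (by omega)
  refine wp_framed ?_
  refine wp_seq (wp_normalise hM hN (L := 2 * ((m + 1) * (n + 1))) (by omega) (by omega) hW
    (fun _ hi _ hj => natAbs_doubleSum_le_of_lt S hi hj) fun s₁ _ htable => ?_)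
  refine wp_seq (wp_costs hM hN hN₂ htable hV fun s₂ hs₂ hcost => ?_)
  replace htable := htable.frame hs₂ (by decide)
  refine wp_seq (wp_levels hM hN hN₂ htable hcost fun s₃ hs₃ hlevel => ?_)
  replace htable := htable.frame hs₃ (by decide)
  replace hcost := hcost.frame hs₃ (by decide)
  refine wp_seq (wp_reaches hM hN hN₂ htable hV hlevel fun s₄ hs₄ hreach => ?_)
  replace htable := htable.frame hs₄ (by decide)
  replace hcost := hcost.frame hs₄ (by decide)
  replace hlevel := hlevel.frame hs₄ (by decide)
  refine wp_seq (wp_threshold hM hN hN₂ hcost hreach (fun _ _ _ hj => normalized_nonneg hj)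
    fun s₅ hs₅ hq₀ hq hforced hclosed => ?_)
  replace htable := htable.frame hs₅ (by decide)
  replace hlevel := hlevel.frame hs₅ (by decide)
  refine wp_seq (wp_addOffsets hM hN hN₂ htable hV hlevel rfl hq₀ hq fun s₆ _ htable => ?_)
  refine wp_normalise hM hN (L := 5 * ((m + 1) * (n + 1))) (by omega) (by omega) htable
    (fun _ hi _ hj => natAbs_normalized_add_offset_le S _ hi hj) fun s₇ _ htable hs => ?_
  exact post s₇ _ hs hq₀ hforced hclosed htable

/-- Leave a solution of the reconstruction problem in `io` and 1 in `best`, or 0 in `best` if there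
is no solution. -/
def reconstruct : Stmt := build ;; solve ;; emit ;; .ite .zero Var.bad (.best ::= 1) (.best ::= 0)

theorem wp_reconstruct (hbad : s.var .bad = 0) (hS : ∀ i < m, ∀ j < n, (S i j).natAbs + 4 ≤ B)
    (hinput : HasInput m n s S)
    (post : ∀ s', (s'.var .best = 1 ∧ IsSolution m n S (s'.arr .io)) ∨
      (s'.var .best = 0 ∧ ¬ ∃ A, IsSolution m n S A) → Q s') :
    wp (m + 1) (n + 1) B reconstruct Q s := by
  have hpos : 0 < (m + 1) * (n + 1) := Nat.mul_pos m.succ_pos n.succ_pos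
  refine wp_seq (wp_build (by omega) hS hinput fun s₁ _ htable hbad₁ => ?_)
  refine wp_seq (wp_solve hB htable fun s₂ q hs₂ hq hforced hclosed htable => ?_)
  refine wp_seq (wp_emit (by omega) htable (fun i hi j hj =>
    (natAbs_leveled_le S q hi hj).trans_lt (by omega)) fun s₃ _ hio hbad₃ => ?_)
  have hiff : s₃.var .bad = 0 ↔ (∀ i < m, ∀ j < n, InRange (S i j)) ∧
      ∀ i < m + 1, ∀ j < n + 1, leveled m n S q i j ≤ 1 := by
    rw [hbad₃, hs₂.var _ (by decide), hbad₁, and_iff_right hbad]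
  refine ⟨trivial, fun h => ⟨(by omega : 1 ≤ B), post _ (.inl ⟨by simp [Expr.eval], ?_⟩)⟩,
    fun h => ⟨B.zero_le, post _ (.inr ⟨by simp [Expr.eval], ?_⟩)⟩⟩
  · obtain ⟨hrange, hle⟩ := hiff.1 h
    exact (isSolution_of_leveled_le_one hrange hle).congr fun i hi j hj => (hio i hi j hj).symm
  · rintro ⟨A, hA⟩
    exact h (hiff.2 ⟨hA.inRange, hA.leveled_le_one hq hforced hclosed⟩)

end Reconstruct

theorem time_reconstruct_le (hM : 0 < M) (hN : 0 < N) : reconstruct.time M N ≤ 1100 * (M * N) := by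
  have hM' : M ≤ M * N := Nat.le_mul_of_pos_right M hN
  have hN' : N ≤ M * N := Nat.le_mul_of_pos_left N hM
  simp only [reconstruct, build, readWindow, extendTable, clamp, before, solve, normalise, rowMins,
    costs, countZeros, levels, reaches, threshold, raiseRows, raise, addOffsets, emit, sweep,
    sweepRow, tabulate, tabulateMin, minLoop, takeMin, cell, setCell, Axis.get, Axis.put, Stmt.time,
    extent, Expr.size_sub, Expr.size]
  ring_nf
  omega

/-- The program that executes a statement and halts with the value of `v` in register 0. -/
def Stmt.program (c : Stmt) (v : Var) : Program := c.code 0 ++ [.copy 0 v.reg, .halt]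

theorem exists_reach_program {σ : Config} (hB : 5 * (M * N) ≤ B) (hM : 0 < M) (hN : 0 < N)
    (hb : σ.BoundedBy B) (hrep : Rep M N s σ) (hpc : σ.pc = 0) (h : wp M N B c Q s) :
    ∃ t s' σ', t ≤ c.time M N + 1 ∧ Reach (c.program v) B σ t σ' ∧ Halted (c.program v) σ' ∧
      Q s' ∧ σ'.reg 0 = s'.var v ∧
      ∀ k, ∀ i < M, ∀ j < N, σ'.mem (address M N k i j) = s'.arr k i j := by
  obtain ⟨hcode, hcopy, hhalt, -⟩ := codeAt_append.1 (codeAt_suffix [] (c.program v))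
  rw [Stmt.length_code] at hcopy hhalt
  obtain ⟨t, s', σ', ht, reach, hpc', hrep', hQ⟩ := leads_of_wp hB hM hN c hcode hb hrep hpc h
  have hlast : Reach (c.program v) B σ' 1 (σ'.setReg 0 (σ'.reg v.reg)) :=
    .single reach.right (by rwa [hpc']) rfl (reach.right.setReg (reach.right.1 _) _)
  refine ⟨t + 1, s', _, by omega, reach.trans hlast, ?_, hQ, ?_, hrep'.arr⟩
  · simpa only [Halted, Config.setReg, hpc'] using! hhalt
  · simpa only [Config.setReg, Function.update_self] using hrep'.var v

end ArrayProgram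

namespace WindowSum

open RAM ArrayProgram

variable {m n : ℕ}

/-- A matrix, extended by zeros to all pairs of natural numbers. -/
def extend (A : Matrix (Fin m) (Fin n) ℤ) (i j : ℕ) : ℤ :=
  if h : i < m ∧ j < n then A ⟨i, h.1⟩ ⟨j, h.2⟩ else 0

theorem extend_of_lt (A : Matrix (Fin m) (Fin n) ℤ) {i j : ℕ} (hi : i < m) (hj : j < n) :
    extend A i j = A ⟨i, hi⟩ ⟨j, hj⟩ :=
  dif_pos ⟨hi, hj⟩

theorem extend_coe (A : Matrix (Fin m) (Fin n) ℤ) (i : Fin m) (j : Fin n) :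
    extend A i j = A i j :=
  extend_of_lt A i.2 j.2

theorem IsPreimage.isSolution_extend {S : Matrix (Fin m) (Fin n) ℤ}
    {A : Matrix (Fin (m + 1)) (Fin (n + 1)) ℤ} (h : IsPreimage S A) :
    IsSolution m n (extend S) (extend A) := by
  refine ⟨fun i hi j hj => ?_, fun i hi j hj => ?_⟩
  · rw [extend_of_lt A hi hj]
    exact h.1 _ _
  · have hsum := congrFun₂ h.2 ⟨i, hi⟩ ⟨j, hj⟩
    simp only [windowSum, ← extend_coe] at hsum
    exact hsum

theorem IsSolution.isPreimage {S : Matrix (Fin m) (Fin n) ℤ} {A : ℕ → ℕ → ℤ}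
    (h : IsSolution m n (extend S) A) : IsPreimage S fun i j => A i j :=
  ⟨fun i j => h.1 i i.2 j j.2, funext₂ fun i j => (h.2 i i.2 j j.2).trans (extend_coe S i j)⟩

theorem natAbs_le_maxAbs (S : Matrix (Fin m) (Fin n) ℤ) (i : Fin m) (j : Fin n) :
    (S i j).natAbs ≤ maxAbs S :=
  (Finset.le_sup (f := fun j => (S i j).natAbs) (Finset.mem_univ j)).trans
    (Finset.le_sup (f := fun i => Finset.univ.sup fun j => (S i j).natAbs) (Finset.mem_univ i))

theorem len_le_inputLength (S : Matrix (Fin m) (Fin n) ℤ) (i : Fin m) (j : Fin n) :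
    len (S i j) ≤ inputLength S :=
  calc len (S i j)
    _ ≤ ∑ j, len (S i j) :=
      Finset.single_le_sum_of_canonicallyOrdered (f := fun j => len (S i j)) (Finset.mem_univ j)
    _ ≤ ∑ i, ∑ j, len (S i j) :=
      Finset.single_le_sum_of_canonicallyOrdered (f := fun i => ∑ j, len (S i j))
        (Finset.mem_univ i)
    _ ≤ inputLength S := Nat.le_add_left _ _

theorem maxAbs_lt_two_pow_inputLength (S : Matrix (Fin m) (Fin n) ℤ) :
    maxAbs S < 2 ^ inputLength S := by
  have hpos : 0 < 2 ^ inputLength S := Nat.two_pow_pos _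
  refine (Finset.sup_lt_iff hpos).2 fun i _ => (Finset.sup_lt_iff hpos).2 fun j _ => ?_
  exact Nat.size_le.1 ((Nat.le_succ _).trans (len_le_inputLength S i j))

theorem mul_le_inputLength_sq (S : Matrix (Fin m) (Fin n) ℤ) :
    (m + 1) * (n + 1) ≤ inputLength S ^ 2 := by
  rw [sq]
  exact Nat.mul_le_mul (by rw [inputLength]; omega) (by rw [inputLength]; omega)

theorem size_mul_add_maxAbs_le (S : Matrix (Fin m) (Fin n) ℤ) :
    (1200 * ((m + 1) * (n + 1) + maxAbs S)).size ≤ 2 * inputLength S + 12 := by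
  set L := inputLength S
  have hmax : maxAbs S < 2 ^ L := maxAbs_lt_two_pow_inputLength S
  have hmul : (m + 1) * (n + 1) ≤ (2 ^ L) ^ 2 :=
    (mul_le_inputLength_sq S).trans (Nat.pow_le_pow_left Nat.lt_two_pow_self.le 2)
  have hsq : 2 ^ L ≤ (2 ^ L) ^ 2 := Nat.le_self_pow two_ne_zero _
  have hpow : 2 ^ (2 * L + 12) = 4096 * (2 ^ L) ^ 2 := by ring
  rw [Nat.size_le]
  omega

theorem input_boundedBy (S : Matrix (Fin m) (Fin n) ℤ) {B : ℕ}
    (hB : (m + 1) * (n + 1) + maxAbs S ≤ B) : (input S).BoundedBy B := by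
  have hm : m + 1 ≤ (m + 1) * (n + 1) := Nat.le_mul_of_pos_right _ n.succ_pos
  have hn : n + 1 ≤ (m + 1) * (n + 1) := Nat.le_mul_of_pos_left _ m.succ_pos
  refine ⟨fun r => ?_, fun a => ?_⟩
  · simp only [input]
    split_ifs <;> omega
  · simp only [input]
    split_ifs with h
    · exact (natAbs_le_maxAbs S _ _).trans (by omega)
    · exact B.zero_le

theorem input_mem (S : Matrix (Fin m) (Fin n) ℤ) {i j : ℕ} (hi : i < m) (hj : j < n) :
    (input S).mem (i * n + j) = extend S i j := by
  have hdiv : (i * n + j) / n = i := by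
    rw [mul_comm, Nat.mul_add_div (by omega), Nat.div_eq_of_lt hj, add_zero]
  have hmod : (i * n + j) % n = j := by
    rw [mul_comm, Nat.mul_add_mod, Nat.mod_eq_of_lt hj]
  rw [input, extend_of_lt S hi hj]
  simp only [dif_pos (mul_add_lt hi hj), Fin.divNat, Fin.modNat, hdiv, hmod]

/-- The state that is represented by the initial configuration on input `S`. -/
def initialState (S : Matrix (Fin m) (Fin n) ℤ) : State where
  var _ := 0
  arr k i j := (input S).mem (address (m + 1) (n + 1) k i j)

theorem rep_initialState (S : Matrix (Fin m) (Fin n) ℤ) :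
    Rep (m + 1) (n + 1) (initialState S) (input S) where
  dim a := by cases a <;> simp [input, Axis.reg, extent]
  var v := by cases v <;> rfl
  arr _ _ _ _ _ := rfl

theorem address_io (M N i j : ℕ) : address M N .io i j = i * N + j := by
  simp only [address, Arr.index, zero_mul, zero_add]

theorem hasInput_initialState (S : Matrix (Fin m) (Fin n) ℤ) :
    HasInput m n (initialState S) (extend S) := by
  intro i hi j hj
  simp only [initialState, address_io, Nat.div_add_mod', input_mem S hi hj]

theorem wp_reconstruct_initialState (S : Matrix (Fin m) (Fin n) ℤ) {B : ℕ}
    (hB : 12 * ((m + 1) * (n + 1)) + maxAbs S ≤ B) :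
    wp (m + 1) (n + 1) B reconstruct
      (fun s => (s.var .best = 1 ∧ IsSolution m n (extend S) (s.arr .io)) ∨
        (s.var .best = 0 ∧ ¬ ∃ A, IsSolution m n (extend S) A)) (initialState S) := by
  have hpos : 0 < (m + 1) * (n + 1) := Nat.mul_pos m.succ_pos n.succ_pos
  refine wp_reconstruct (by omega) rfl (fun i hi j hj => ?_) (hasInput_initialState S)
    fun _ => id
  have := natAbs_le_maxAbs S ⟨i, hi⟩ ⟨j, hj⟩
  rw [extend_of_lt S hi hj]
  omega

theorem exists_reach_answers (S : Matrix (Fin m) (Fin n) ℤ) {B : ℕ}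
    (hB : 12 * ((m + 1) * (n + 1)) + maxAbs S ≤ B) :
    ∃ t σ, t ≤ 1200 * ((m + 1) * (n + 1)) ∧ Reach (reconstruct.program .best) B (input S) t σ ∧
      Halted (reconstruct.program .best) σ ∧ Answers S σ := by
  have hm : 0 < m + 1 := m.succ_pos
  have hn : 0 < n + 1 := n.succ_pos
  have hpos : 0 < (m + 1) * (n + 1) := Nat.mul_pos hm hn
  obtain ⟨t, s, σ, ht, reach, hhalt, hans, hreg, hmem⟩ := exists_reach_program (v := .best)
    (by omega) hm hn (input_boundedBy S (by omega)) (rep_initialState S) rfl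
    (wp_reconstruct_initialState S hB)
  have htime := time_reconstruct_le hm hn
  have hout : output (m + 1) (n + 1) σ =
      fun (i : Fin (m + 1)) (j : Fin (n + 1)) => s.arr .io i j := by
    funext i j
    rw [output, ← address_io (m + 1), hmem _ i i.2 j j.2]
  refine ⟨t, σ, by omega, reach, hhalt, ?_⟩
  rw [Answers, hreg, hout]
  exact hans.imp (fun ⟨hbest, hsol⟩ => ⟨hbest, hsol.isPreimage⟩)
    fun ⟨hbest, hno⟩ => ⟨hbest, fun ⟨_, hA⟩ => hno ⟨_, hA.isSolution_extend⟩⟩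

end WindowSum

/-- One program finds a 0-1 matrix with the given sums over `2 × 2` windows, or reports that there
is none. Its number of steps is linear in the number of entries of the matrix, it uses only words of
logarithmic length (numbers bounded by a multiple of the number of entries plus the largest input
number), and its logarithmic cost, hence its bit complexity, is polynomial in the length of the
input. -/
theorem theorem1 :
    ∃ (P : RAM.Program) (c : ℕ) (p : Polynomial ℕ),
      ∀ (m n : ℕ) (S : Matrix (Fin m) (Fin n) ℤ),
        (∃ (t w : ℕ) (s : RAM.Config),
          RAM.Run P (WindowSum.input S) t w s ∧ RAM.Halted P s ∧ WindowSum.Answers S s ∧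
            t ≤ c * ((m + 1) * (n + 1)) ∧
            w ≤ p.eval (WindowSum.inputLength S)) ∧
        ∀ (t w : ℕ) (s : RAM.Config), RAM.Run P (WindowSum.input S) t w s →
          s.BoundedBy (c * ((m + 1) * (n + 1) + WindowSum.maxAbs S)) := by
  refine ⟨ArrayProgram.reconstruct.program .best, 1200,
    .C 1200 * .X ^ 2 * (.C 2 * (.C 2 * .X + .C 13)), fun m n S => ?_⟩
  obtain ⟨t, s, ht, hreach, hhalt, hans⟩ := WindowSum.exists_reach_answers S
    (B := 1200 * ((m + 1) * (n + 1) + WindowSum.maxAbs S)) (by omega)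
  obtain ⟨w, hw, hrun⟩ := hreach.run
  refine ⟨⟨t, w, s, hrun, hhalt, hans, ht, hw.trans ?_⟩,
    fun t' w' s' hrun' => hreach.boundedBy_of_run hhalt hrun'⟩
  simp only [Polynomial.eval_mul, Polynomial.eval_C, Polynomial.eval_pow, Polynomial.eval_X,
    Polynomial.eval_add]
  have hsize := WindowSum.size_mul_add_maxAbs_le S
  exact Nat.mul_le_mul (ht.trans (Nat.mul_le_mul_left _ (WindowSum.mul_le_inputLength_sq S)))
    (by omega)
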